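/- **Torsion Theorem.** Let $G$ be a finite graph (loops and multiple edges are allowed) with $v$ vertices and a fixed linear order on its edge set $E$, and let $\mathcal A_2=\mathbb Z[x]/(x^2)$, graded by $\deg 1=0$ and $\deg x=1$. For $s\subseteq E$ let $[G:s]$ be the spanning subgraph with edge set $s$, and let $C^s(G)$ be the tensor product over $\mathbb Z$ of one copy of $\mathcal A_2$ for each connected component of $[G:s]$, with the induced grading. Put $C^i(G)=\bigoplus_{|s|=i}C^s(G)$. The differential $d^i:C^i(G)\to C^{i+1}(G)$ is the sum, over all $s$ with $|s|=i$ and all $e\in E\setminus s$, of $(-1)^{\#\{e'\in s\,:\,e'<e\}}$ times the map $C^s(G)\to C^{s\cup\{e\}}(G)$ that is the identity if $e$ joins a component of $[G:s]$ to itself, and that multiplies the two corresponding tensor factors (and is the identity on the others) if $e$ joins two different components. Let $H^i(G)=\ker d^i/\operatorname{im}d^{i-1}$ and $H^*(G)=\bigoplus_i H^i(G)$, and let $H^{i,j}(G)$ be the cohomology at $i$ of the subcomplex of homogeneous elements of degree $j$. A cycle of length $n$ in $G$ consists of $n$ distinct vertices $v_0,\dots,v_{n-1}$ and $n$ distinct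 edges $e_0,\dots,e_{n-1}$ such that $e_k$ joins $v_k$ and $v_{k+1}$ (indices modulo $n$). Then: 1. $H^*(G)$ contains a non-zero torsion element if and only if $G$ has no loops and contains a cycle of length $\ge 3$. 2. Suppose that $G$ has no loops. If $G$ contains a cycle of odd length $\ge 3$, then $H^{1,v-1}(G)$ contains $\mathbb Z_2$-torsion, that is, an element of order $2$. If $G$ contains a cycle of even length $\ge 4$, then $H^{2,v-2}(G)$ contains $\mathbb Z_2$-torsion, that is, an element of order $2$. -/

import Mathlib

open scoped Graph Polynomial TensorProduct DirectSum

noncomputable section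

namespace GraphCohomology

/-- The algebra `R[x]/(x²)`. Everything below is written over a commutative ring `R`; the integral
theory is the case `R = ℤ`. -/
abbrev A2 (R : Type*) [CommRing R] : Type _ := AdjoinRoot (Polynomial.X ^ 2 : R[X])

/-- The homogeneous elements of degree `k` of `R[x]/(x²)`, where `x` has degree `1`: the multiples
of `x ^ k` (so this is `0` for `2 ≤ k`). -/
def A2.homogeneous (R : Type*) [CommRing R] (k : ℕ) : Submodule R (A2 R) :=
  Submodule.span R {AdjoinRoot.root (Polynomial.X ^ 2 : R[X]) ^ k}

variable (R : Type*) [CommRing R] {α β : Type*} (G : Graph α β)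

/-- `G` contains a cycle of length `n`: there are `n ≥ 1` distinct vertices `v 0, …, v (n - 1)` and
`n` distinct edges `e 0, …, e (n - 1)`, such that `e i` joins `v i` to `v (i + 1)`, indices being
taken modulo `n`. -/
def HasCycle (n : ℕ) : Prop :=
  0 < n ∧ ∃ (v : Fin n → α) (e : Fin n → β), Function.Injective v ∧ Function.Injective e ∧
    ∀ i, G.IsLink (e i) (v i) (v (finRotate n i))

/-- The set of connected components of the spanning subgraph `[G : s]`, which has the vertex set of
`G` and the edge set `s`. -/
def Component (s : Finset E(G)) : Type _ :=
  Quot fun x y : V(G) => ∃ e ∈ s, G.IsLink (e : β) (x : α) (y : α)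

instance [Finite V(G)] (s : Finset E(G)) : Finite (Component G s) :=
  inferInstanceAs (Finite (Quot _))

instance [Finite V(G)] (s : Finset E(G)) : Fintype (Component G s) := Fintype.ofFinite _

variable {G}

/-- For `s ⊆ t`, the component of `[G : t]` that contains a given component of `[G : s]`. -/
def Component.incl {s t : Finset E(G)} (h : s ⊆ t) : Component G s → Component G t :=
  Quot.map id fun _ _ ⟨e, he, hl⟩ => ⟨e, h he, hl⟩

variable (G)

/-- The module `C^s(G)` attached to the vertex `s` of the cube of sets of edges: one tensor factor
`R[x]/(x²)` for each connected component of `[G : s]`. -/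
abbrev VertexModule (s : Finset E(G)) : Type _ := ⨂[R] _ : Component G s, A2 R

/-- The homogeneous elements of degree `j` of the module attached to `s`: they are generated by the
tensor products of homogeneous elements whose degrees have sum `j`. -/
def VertexModule.homogeneous [Finite V(G)] (s : Finset E(G)) (j : ℕ) :
    Submodule R (VertexModule R G s) :=
  Submodule.span R {y | ∃ (k : Component G s → ℕ) (a : Component G s → A2 R),
    (∀ c, a c ∈ A2.homogeneous R (k c)) ∧ ∑ c, k c = j ∧ y = PiTensorProduct.tprod R a}

variable {G}

open Classical in
/-- Helper for the multilinearity of `mergeMultilinear`. -/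
lemma mergeFun_update [Finite V(G)] {s t : Finset E(G)} (h : s ⊆ t) [DecidableEq (Component G s)]
    (a : Component G s → A2 R) (c : Component G s) (x : A2 R) :
    (PiTensorProduct.tprod R fun c' =>
      ∏ b with Component.incl h b = c', Function.update a c x b : VertexModule R G t) =
    PiTensorProduct.tprod R (Function.update
      (fun c' => ∏ b with Component.incl h b = c', a b) (Component.incl h c)
      (x * ∏ b with Component.incl h b = Component.incl h c ∧ b ≠ c, a b)) := by
  congr 1
  funext c'
  by_cases hc : c' = Component.incl h c
  · subst hc
    rw [Function.update_self, ← Finset.filter_filter, Finset.filter_ne',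
      ← Finset.mul_prod_erase _ _ (show c ∈ _ by simp), Function.update_self]
    congr 1
    refine Finset.prod_congr rfl fun b hb => ?_
    rw [Function.update_of_ne (Finset.ne_of_mem_erase hb)]
  · rw [Function.update_of_ne hc]
    refine Finset.prod_congr rfl fun b hb => ?_
    rw [Function.update_of_ne]
    rintro rfl
    exact hc (Finset.mem_filter.1 hb).2.symm

open Classical in
/-- For `s ⊆ t`, the multilinear map that multiplies the elements of all those components of
`[G : s]` that lie in the same component of `[G : t]`. -/
def mergeMultilinear [Finite V(G)] {s t : Finset E(G)} (h : s ⊆ t) :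
    MultilinearMap R (fun _ : Component G s => A2 R) (VertexModule R G t) where
  toFun a := PiTensorProduct.tprod R fun c' => ∏ c with Component.incl h c = c', a c
  map_update_add' a c x y := by
    rw [mergeFun_update, mergeFun_update, mergeFun_update, add_mul, MultilinearMap.map_update_add]
  map_update_smul' a c r x := by
    rw [mergeFun_update, mergeFun_update, smul_mul_assoc, MultilinearMap.map_update_smul]

/-- The map of modules attached to `s ⊆ t`. When `t = s ∪ {e}`, this is the per-edge map: if `e`
joins a component of `[G : s]` to itself, the components of `[G : s]` and of `[G : t]` correspond
and this is the identity; if `e` joins two different components, it is the multiplication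
`x ⊗ y ↦ x y` on the two factors of these and the identity on all the other factors. -/
def merge [Finite V(G)] {s t : Finset E(G)} (h : s ⊆ t) :
    VertexModule R G s →ₗ[R] VertexModule R G t :=
  PiTensorProduct.lift (mergeMultilinear R h)

variable (G)

/-- The cochain module `C^i(G)`: the direct sum of the modules attached to the sets of edges with
`i` elements (there are finitely many of these, as graphs are finite). -/
abbrev Cochain (i : ℕ) : Type _ := ∀ s : {s : Finset E(G) // s.card = i}, VertexModule R G s.1

/-- The module `C^{i,j}(G)` of homogeneous cochains of degree `j`. -/
def Cochain.homogeneous [Finite V(G)] (i j : ℕ) : Submodule R (Cochain R G i) :=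
  Submodule.pi Set.univ fun s => VertexModule.homogeneous R G s.1 j

/-- The differential `d^i : C^i(G) → C^{i+1}(G)`. Its component at a set `t` of `i + 1` edges is the
sum, over the edges `e` in `t`, of the per-edge maps from `t \ {e}` to `t`, with the sign
`(-1)` to the number of edges of `t \ {e}` that come before `e`. -/
def d [Finite V(G)] [LinearOrder E(G)] (i : ℕ) : Cochain R G i →ₗ[R] Cochain R G (i + 1) :=
  LinearMap.pi fun t => ∑ e : {e // e ∈ t.1},
    (-1 : R) ^ ((t.1.erase e.1).filter (· < e.1)).card •
      (merge R (Finset.erase_subset e.1 t.1) ∘ₗ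
        LinearMap.proj (⟨t.1.erase e.1, by rw [Finset.card_erase_of_mem e.2, t.2]; rfl⟩ :
          {s : Finset E(G) // s.card = i}))

/-- The coboundaries in `C^i(G)`: the image of `d^{i-1}`, which is `0` for `i = 0`. -/
def coboundaries [Finite V(G)] [LinearOrder E(G)] : ∀ i : ℕ, Submodule R (Cochain R G i)
  | 0 => ⊥
  | i + 1 => LinearMap.range (d R G i)

/-- The cohomology `H^i(G) = ker d^i / im d^{i-1}`. -/
def Cohomology [Finite V(G)] [LinearOrder E(G)] (i : ℕ) : Type _ :=
  LinearMap.ker (d R G i) ⧸ (coboundaries R G i).submoduleOf (LinearMap.ker (d R G i))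

instance [Finite V(G)] [LinearOrder E(G)] (i : ℕ) : AddCommGroup (Cohomology R G i) :=
  inferInstanceAs (AddCommGroup
    (LinearMap.ker (d R G i) ⧸ (coboundaries R G i).submoduleOf (LinearMap.ker (d R G i))))

instance [Finite V(G)] [LinearOrder E(G)] (i : ℕ) : Module R (Cohomology R G i) :=
  inferInstanceAs (Module R
    (LinearMap.ker (d R G i) ⧸ (coboundaries R G i).submoduleOf (LinearMap.ker (d R G i))))

/-- The cocycles in `C^{i,j}(G)`. -/
def gradedCocycles [Finite V(G)] [LinearOrder E(G)] (i j : ℕ) : Submodule R (Cochain R G i) :=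
  LinearMap.ker (d R G i) ⊓ Cochain.homogeneous R G i j

/-- The coboundaries in `C^{i,j}(G)`: the image of `C^{i-1,j}(G)` under `d^{i-1}`, which is `0` for
`i = 0`. -/
def gradedCoboundaries [Finite V(G)] [LinearOrder E(G)] :
    ∀ i : ℕ, ℕ → Submodule R (Cochain R G i)
  | 0, _ => ⊥
  | i + 1, j => (Cochain.homogeneous R G i j).map (d R G i)

/-- The cohomology `H^{i,j}(G)`, at `i`, of the complex of homogeneous cochains of degree `j`. -/
def GradedCohomology [Finite V(G)] [LinearOrder E(G)] (i j : ℕ) : Type _ :=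
  gradedCocycles R G i j ⧸ (gradedCoboundaries R G i j).submoduleOf (gradedCocycles R G i j)

instance [Finite V(G)] [LinearOrder E(G)] (i j : ℕ) : AddCommGroup (GradedCohomology R G i j) :=
  inferInstanceAs (AddCommGroup
    (gradedCocycles R G i j ⧸ (gradedCoboundaries R G i j).submoduleOf (gradedCocycles R G i j)))

instance [Finite V(G)] [LinearOrder E(G)] (i j : ℕ) : Module R (GradedCohomology R G i j) :=
  inferInstanceAs (Module R
    (gradedCocycles R G i j ⧸ (gradedCoboundaries R G i j).submoduleOf (gradedCocycles R G i j)))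

/-- The cohomology `H^*(G)`, the direct sum of all the `H^i(G)`. -/
abbrev TotalCohomology [Finite V(G)] [LinearOrder E(G)] : Type _ :=
  ⨁ i : ℕ, Cohomology R G i

end GraphCohomology

end

/-!
The cube of modules is studied through families of elements indexed by all sets of edges, with one
differential `totalD` for all degrees at once. Any map of components `f` induces a map `push f` of
tensor powers of `ℤ[x]/(x²)`, functorially; the per-edge maps are of this kind, and maps of
components in the opposite direction provide right inverses to them.

*No torsion.* Suppose that a map `r` of vertices is a retraction along the edge `e`
(`IsRetraction`). It induces right inverses, compatible with the differential, of the maps that add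
`e` to a set of edges. With these every cocycle can be changed by a coboundary so as to vanish on
all sets that contain `e`, and exactness in positive degrees passes from the graph without `e` to
the graph with `e` (`IsRetraction.exact_pos`). If `e` is a loop, `r` is the identity and the whole
complex is exact (`exact_of_not_loopless`). If `G` has no loops and no cycles of length at least
`3`, it is a forest up to parallel edges, an end of a longest path has a single neighbour, and
moving the former to the latter is a retraction (`exists_isRetraction`). By induction on the number
of edges, the cohomology vanishes in positive degrees, and in degree `0` it is contained in a free
module.

*Torsion.* Let `topElem s` be the tensor product of factors `x` only, and `sumMark s` the sum of the
tensor products with exactly one factor `1` and all other factors `x`. Modulo `2` this is the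
derivative of `topElem s`, and `d/dx` is compatible with the differential modulo `2`. Hence suitable
combinations `φ` of the elements `sumMark s` have coboundaries divisible by `2`, and
`z = d φ / 2` is a cocycle with `2 z = d φ`. If `z = d ψ`, then `φ - 2 ψ` is an integral cocycle
congruent to `φ` modulo `2`, and the coefficients of `topElem` in its coboundary give linear
relations around the cycle.
For an odd cycle, `φ = sumMark ∅`: the relations say that an odd integer changes sign along each
edge, which is impossible (`isTorsionWitness_of_odd`). For an even cycle of length at least `4`,
`φ` is the sum of `sumMark {f}` over all `f` parallel to one edge of the cycle: an alternating sum
of the relations over all pairs of edges of the cycle shows that the number of edges of the cycle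
that are parallel to the chosen one is even, while this number is `1`
(`even_sum_of_symmetric`, `isTorsionWitness_of_even`).
-/

open scoped Graph Polynomial TensorProduct DirectSum

noncomputable section

namespace GraphCohomology

/-! ### Maps of tensor powers induced by maps of components -/

section Push

variable (R : Type*) [CommRing R] {α β : Type*} {G : Graph α β} [Finite V(G)]

open Classical in
/-- The linear map on tensor powers of `R[x]/(x²)` induced by an arbitrary map `f` of components:
the factors over each fibre of `f` are multiplied, and the factors outside the range of `f` are `1`.
The per-edge maps are those induced by `Component.incl`. -/
def push {s t : Finset E(G)} (f : Component G s → Component G t) :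
    VertexModule R G s →ₗ[R] VertexModule R G t :=
  PiTensorProduct.lift ((MultilinearMap.mkPiAlgebra R (Component G s)
    (VertexModule R G t)).compLinearMap fun c =>
      (PiTensorProduct.singleAlgHom (A := fun _ => A2 R) (f c)).toLinearMap)

open Classical in
lemma push_tprod {s t : Finset E(G)} (f : Component G s → Component G t)
    (a : Component G s → A2 R) :
    push R f (PiTensorProduct.tprod R a) =
      PiTensorProduct.tprod R fun c' => ∏ c with f c = c', a c := by
  simp only [push, PiTensorProduct.lift.tprod, MultilinearMap.compLinearMap_apply,
    MultilinearMap.mkPiAlgebra_apply, AlgHom.toLinearMap_apply, PiTensorProduct.singleAlgHom_apply]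
  rw [← PiTensorProduct.tprod_prod]
  congr 1
  funext c'
  rw [Finset.prod_apply, Finset.prod_filter]
  refine Finset.prod_congr rfl fun c _ => ?_
  by_cases h : f c = c'
  · subst h; simp
  · rw [if_neg h]; exact Pi.mulSingle_eq_of_ne (Ne.symm h) _

lemma merge_eq_push {s t : Finset E(G)} (h : s ⊆ t) :
    merge R h = push R (Component.incl h) := by
  refine PiTensorProduct.ext (MultilinearMap.ext fun a => ?_)
  simp only [LinearMap.compMultilinearMap_apply, merge, PiTensorProduct.lift.tprod, push_tprod]
  rfl

lemma push_push {s t u : Finset E(G)} (f : Component G s → Component G t)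
    (g : Component G t → Component G u) (x : VertexModule R G s) :
    push R g (push R f x) = push R (g ∘ f) x := by
  classical
  suffices h : push R g ∘ₗ push R f = push R (g ∘ f) from LinearMap.congr_fun h x
  refine PiTensorProduct.ext (MultilinearMap.ext fun a => ?_)
  simp only [LinearMap.compMultilinearMap_apply, LinearMap.comp_apply, push_tprod]
  congr 1
  funext c''
  rw [← Finset.prod_fiberwise_of_maps_to (t := Finset.univ.filter fun c' => g c' = c'')
    (g := f) (by simp)]
  refine Finset.prod_congr rfl fun c' hc' => Finset.prod_congr ?_ fun _ _ => rfl
  ext c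
  simp only [Finset.mem_filter, Finset.mem_univ, true_and, Function.comp] at hc' ⊢
  grind

lemma push_id {s : Finset E(G)} (f : Component G s → Component G s) (hf : ∀ c, f c = c)
    (x : VertexModule R G s) : push R f x = x := by
  classical
  obtain rfl : f = id := funext hf
  suffices h : push R id = LinearMap.id from LinearMap.congr_fun h x
  refine PiTensorProduct.ext (MultilinearMap.ext fun a => ?_)
  simp only [LinearMap.compMultilinearMap_apply, push_tprod, LinearMap.id_apply]
  refine congrArg _ (funext fun c => ?_)
  rw [Finset.prod_filter]
  simp

end Push

/-! ### Components of spanning subgraphs -/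

section Component

variable {α β : Type*} {G : Graph α β}

/-- The component of `[G : s]` that contains the vertex `x`. -/
def Component.mk (s : Finset E(G)) (x : V(G)) : Component G s := Quot.mk _ x

@[simp] lemma Component.incl_mk {s t : Finset E(G)} (h : s ⊆ t) (x : V(G)) :
    Component.incl h (Component.mk s x) = Component.mk t x := rfl

lemma Component.mk_surjective (s : Finset E(G)) : Function.Surjective (Component.mk s) :=
  Quot.mk_surjective

lemma Component.mk_eq {s : Finset E(G)} {e : E(G)} (he : e ∈ s) {x y : V(G)}
    (h : G.IsLink (e : β) (x : α) (y : α)) : Component.mk s x = Component.mk s y :=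
  Quot.sound ⟨e, he, h⟩

/-- A map of vertices that takes the ends of each edge in `s` into one component of `[G : t]`
induces a map of components. -/
def Component.lift {s : Finset E(G)} {X : Type*} (r : V(G) → X)
    (h : ∀ e ∈ s, ∀ x y : V(G), G.IsLink (e : β) (x : α) (y : α) → r x = r y) :
    Component G s → X :=
  Quot.lift r fun x y ⟨e, he, hl⟩ => h e he x y hl

@[simp] lemma Component.lift_mk {s : Finset E(G)} {X : Type*} (r : V(G) → X)
    (h : ∀ e ∈ s, ∀ x y : V(G), G.IsLink (e : β) (x : α) (y : α) → r x = r y) (x : V(G)) :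
    Component.lift r h (Component.mk s x) = r x := rfl

end Component

/-! ### Families indexed by all sets of edges -/

section Families

variable (R : Type*) [CommRing R] {α β : Type*} {G : Graph α β}

/-- Extension by zero of a cochain to a family indexed by all sets of edges. -/
def extendZero {i : ℕ} (ψ : Cochain R G i) (s : Finset E(G)) : VertexModule R G s :=
  if h : s.card = i then ψ ⟨s, h⟩ else 0

lemma extendZero_of_card {i : ℕ} (ψ : Cochain R G i) {s : Finset E(G)} (h : s.card = i) :
    extendZero R ψ s = ψ ⟨s, h⟩ := dif_pos h

lemma extendZero_of_ne {i : ℕ} (ψ : Cochain R G i) {s : Finset E(G)} (h : s.card ≠ i) :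
    extendZero R ψ s = 0 := dif_neg h

lemma restrict_extendZero {i : ℕ} (ψ : Cochain R G i) :
    (fun s : {s : Finset E(G) // s.card = i} => extendZero R ψ s.1) = ψ := by
  funext s
  exact extendZero_of_card R ψ s.2

variable [Finite V(G)]

lemma merge_congr_set {s s' t : Finset E(G)} (h : s = s') (hs : s ⊆ t) (hs' : s' ⊆ t)
    (ψ : ∀ s : Finset E(G), VertexModule R G s) : merge R hs (ψ s) = merge R hs' (ψ s') := by
  subst h; rfl

lemma merge_merge {s t u : Finset E(G)} (h : s ⊆ t) (h' : t ⊆ u) (x : VertexModule R G s) :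
    merge R h' (merge R h x) = merge R (h.trans h') x := by
  simp only [merge_eq_push, push_push]
  congr 2
  funext c
  obtain ⟨x, rfl⟩ := Component.mk_surjective s c
  rfl

end Families

/-! ### The differential and its square -/

section Differential

variable (R : Type*) [CommRing R] {α β : Type*} {G : Graph α β} [LinearOrder E(G)]

/-- The sign with which the edge `e` of `t` enters the differential at `t`. -/
def edgeSign (t : Finset E(G)) (e : E(G)) : R := (-1) ^ ((t.erase e).filter (· < e)).card

lemma edgeSign_mul_self (t : Finset E(G)) (e : E(G)) : edgeSign R t e * edgeSign R t e = 1 := by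
  rw [edgeSign, ← mul_pow]; simp

lemma edgeSign_smul_smul {M : Type*} [AddCommGroup M] [Module R M] (t : Finset E(G)) (e : E(G))
    (x : M) : edgeSign R t e • edgeSign R t e • x = x := by
  rw [smul_smul, edgeSign_mul_self, one_smul]

lemma edgeSign_swap {t : Finset E(G)} {e f : E(G)} (he : e ∈ t) (hf : f ∈ t) (hne : e ≠ f) :
    edgeSign R t e * edgeSign R (t.erase e) f = -(edgeSign R t f * edgeSign R (t.erase f) e) := by
  have key : ∀ {e f : E(G)}, e ∈ t → f ∈ t → e < f →
      edgeSign R t e * edgeSign R (t.erase e) f =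
        -(edgeSign R t f * edgeSign R (t.erase f) e) := by
    intro e f he hf hlt
    have h1 : ((t.erase f).filter (· < f)).card
        = (((t.erase e).erase f).filter (· < f)).card + 1 := by
      have : (((t.erase e).erase f).filter (· < f)) = ((t.erase f).filter (· < f)).erase e := by
        ext; simp; tauto
      rw [this, Finset.card_erase_add_one]
      simp [hlt, he, hlt.ne]
    have h2 : ((t.erase f).erase e).filter (· < e) = (t.erase e).filter (· < e) := by
      ext x; simp
      intro hx _ _ hxf
      exact absurd (hxf ▸ hx) hlt.not_gt
    simp only [edgeSign]
    rw [h1, h2]; ring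
  rcases lt_or_gt_of_ne hne with h | h
  · exact key he hf h
  · rw [key hf he h, neg_neg]

variable [Finite V(G)]

/-- The differential on families of elements indexed by all sets of edges, without regard to the
number of edges. -/
def totalD : (∀ s : Finset E(G), VertexModule R G s) →ₗ[R] ∀ s : Finset E(G), VertexModule R G s :=
  LinearMap.pi fun t => ∑ e ∈ t, edgeSign R t e •
    (merge R (Finset.erase_subset e t) ∘ₗ LinearMap.proj (t.erase e))

lemma totalD_apply (ψ : ∀ s : Finset E(G), VertexModule R G s) (t : Finset E(G)) :
    totalD R ψ t = ∑ e ∈ t, edgeSign R t e • merge R (Finset.erase_subset e t) (ψ (t.erase e)) := by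
  simp [totalD]

lemma totalD_insert (ψ : ∀ s : Finset E(G), VertexModule R G s) {s : Finset E(G)} {e : E(G)}
    (he : e ∉ s) :
    totalD R ψ (insert e s) =
      edgeSign R (insert e s) e • merge R (Finset.subset_insert e s) (ψ s) +
      ∑ f ∈ s, edgeSign R (insert e s) f •
        merge R (Finset.erase_subset f _) (ψ ((insert e s).erase f)) := by
  rw [totalD_apply, Finset.sum_insert he]
  congr 2
  exact merge_congr_set R (Finset.erase_insert he) _ _ ψ

/-- If `ψ` vanishes on all sets obtained from `insert e s` by removing an edge of `s`, then only one
term of its differential at `insert e s` remains. -/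
lemma totalD_insert_of_vanish (ψ : ∀ s : Finset E(G), VertexModule R G s) {s : Finset E(G)}
    {e : E(G)} (he : e ∉ s) (h : ∀ f ∈ s, ψ ((insert e s).erase f) = 0) :
    totalD R ψ (insert e s) =
      edgeSign R (insert e s) e • merge R (Finset.subset_insert e s) (ψ s) := by
  rw [totalD_insert R ψ he, Finset.sum_eq_zero, add_zero]
  intro f hf
  rw [h f hf, map_zero, smul_zero]

/-- The two orders of removing the edges `e` and `f` contribute with opposite signs. -/
lemma totalD_totalD (ψ : ∀ s : Finset E(G), VertexModule R G s) : totalD R (totalD R ψ) = 0 := by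
  funext t
  have h1 : totalD R (totalD R ψ) t = ∑ e ∈ t, ∑ f ∈ t.erase e,
      (edgeSign R t e * edgeSign R (t.erase e) f) •
        merge R ((Finset.erase_subset f _).trans (Finset.erase_subset e t))
          (ψ ((t.erase e).erase f)) := by
    rw [totalD_apply]
    refine Finset.sum_congr rfl fun e _ => ?_
    rw [totalD_apply, map_sum, Finset.smul_sum]
    refine Finset.sum_congr rfl fun f _ => ?_
    rw [map_smul, smul_smul, merge_merge]
  rw [h1, Finset.sum_sigma']
  refine Finset.sum_involution (fun p _ => ⟨p.2, p.1⟩) ?_ ?_ ?_ ?_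
  · rintro ⟨e, f⟩ h
    simp only [Finset.mem_sigma, Finset.mem_erase] at h ⊢
    rw [edgeSign_swap R h.1 h.2.2 h.2.1.symm, neg_smul,
      merge_congr_set R (Finset.erase_right_comm (s := t) (a := e) (b := f)) _
        ((Finset.erase_subset e _).trans (Finset.erase_subset f t)) ψ, neg_add_cancel]
  · rintro ⟨e, f⟩ h _ heq
    simp only [Finset.mem_sigma, Finset.mem_erase] at h
    simp only [Sigma.mk.injEq, heq_eq_eq] at heq
    exact h.2.1 heq.1
  · rintro ⟨e, f⟩ h
    simp only [Finset.mem_sigma, Finset.mem_erase] at h ⊢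
    tauto
  · rintro ⟨e, f⟩ h; rfl

lemma d_restrict (i : ℕ) (ψ : ∀ s : Finset E(G), VertexModule R G s)
    (t : {t : Finset E(G) // t.card = i + 1}) :
    d R G i (fun s => ψ s.1) t = totalD R ψ t.1 := by
  rw [totalD_apply, ← Finset.sum_coe_sort]
  simp only [d, LinearMap.pi_apply, LinearMap.sum_apply, LinearMap.smul_apply,
    LinearMap.comp_apply, LinearMap.proj_apply, edgeSign]

lemma d_eq_totalD {i : ℕ} (ψ : Cochain R G i) (t : {t : Finset E(G) // t.card = i + 1}) :
    d R G i ψ t = totalD R (extendZero R ψ) t.1 := by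
  conv_lhs => rw [← restrict_extendZero R ψ]
  exact d_restrict R i _ t

lemma totalD_extendZero_of_ne {i : ℕ} (ψ : Cochain R G i) {t : Finset E(G)}
    (h : t.card ≠ i + 1) : totalD R (extendZero R ψ) t = 0 := by
  rw [totalD_apply]
  refine Finset.sum_eq_zero fun e he => ?_
  rw [extendZero_of_ne, map_zero, smul_zero]
  rw [Finset.card_erase_of_mem he]
  have := Finset.card_pos.2 ⟨e, he⟩
  omega

lemma d_d (i : ℕ) (ψ : Cochain R G i) : d R G (i + 1) (d R G i ψ) = 0 := by
  have h : d R G i ψ =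
      fun t : {t : Finset E(G) // t.card = i + 1} => totalD R (extendZero R ψ) t.1 :=
    funext (d_eq_totalD R ψ)
  funext t
  rw [h, d_restrict, totalD_totalD]; rfl

end Differential

lemma mem_erase_insert {γ : Type*} [DecidableEq γ] {s : Finset γ} {e f : γ} (he : e ∉ s)
    (hf : f ∈ s) : e ∈ (insert e s).erase f :=
  Finset.mem_erase.2 ⟨ne_of_mem_of_not_mem hf he |>.symm, Finset.mem_insert_self e s⟩

/-! ### Exactness along a retraction -/

section Retraction

variable (R : Type*) [CommRing R] {α β : Type*} {G : Graph α β}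

/-- A map `r` of vertices that moves vertices only along the edge `e`, identifies the ends of `e`,
and takes each edge in `B` either to itself or to a single vertex. The two examples that matter are
the identity, if `e` is a loop, and the map that takes `u` to `w` and fixes all other vertices, if
`e` joins `u` to `w` and every edge in `B` at `u` joins `u` to `w`. -/
structure IsRetraction (B : Finset E(G)) (e : E(G)) (r : V(G) → V(G)) : Prop where
  eq_or_isLink : ∀ x, r x = x ∨ G.IsLink (e : β) (x : α) (r x : α)
  eq_of_isLink : ∀ x y : V(G), G.IsLink (e : β) (x : α) (y : α) → r x = r y
  eq_or_fixed : ∀ f ∈ B, ∀ x y : V(G), G.IsLink (f : β) (x : α) (y : α) →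
    r x = r y ∨ (r x = x ∧ r y = y)

variable {R} [LinearOrder E(G)] {B : Finset E(G)} {e : E(G)} {r : V(G) → V(G)}

lemma IsRetraction.mk_eq_of_mem (hr : IsRetraction B e r) {s : Finset E(G)} (hs : insert e s ⊆ B)
    (f : E(G)) (hf : f ∈ insert e s) (x y : V(G)) (hl : G.IsLink (f : β) (x : α) (y : α)) :
    Component.mk s (r x) = Component.mk s (r y) := by
  rcases Finset.mem_insert.1 hf with rfl | hf'
  · rw [hr.eq_of_isLink x y hl]
  · rcases hr.eq_or_fixed f (hs hf) x y hl with h | ⟨h, h'⟩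
    · rw [h]
    · rw [h, h']; exact Component.mk_eq hf' hl

lemma IsRetraction.mk_insert (hr : IsRetraction B e r) (s : Finset E(G)) (x : V(G)) :
    Component.mk (insert e s) (r x) = Component.mk (insert e s) x := by
  rcases hr.eq_or_isLink x with h | h
  · rw [h]
  · exact (Component.mk_eq (Finset.mem_insert_self e s) h).symm

variable (R) [Finite V(G)]

/-- The right inverse, induced by a retraction along `e`, of the per-edge map that adds the edge
`e` to `s`; the value is `0` where the retraction does not apply. -/
def IsRetraction.rightInv (hr : IsRetraction B e r) (s : Finset E(G)) :
    VertexModule R G (insert e s) →ₗ[R] VertexModule R G s :=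
  if hs : insert e s ⊆ B then
    push R (Component.lift (fun x => Component.mk s (r x)) (hr.mk_eq_of_mem hs))
  else 0

lemma IsRetraction.merge_rightInv (hr : IsRetraction B e r) {s : Finset E(G)} (hs : insert e s ⊆ B)
    (x : VertexModule R G (insert e s)) :
    merge R (Finset.subset_insert e s) (hr.rightInv R s x) = x := by
  rw [IsRetraction.rightInv, dif_pos hs, merge_eq_push, push_push]
  refine push_id R _ (fun c => ?_) x
  obtain ⟨v, rfl⟩ := Component.mk_surjective _ c
  exact hr.mk_insert s v

/-- The endomorphisms that the retraction induces commute with the per-edge maps. -/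
lemma IsRetraction.rightInv_merge (hr : IsRetraction B e r) {s t : Finset E(G)}
    (hst : s ⊆ t) (ht : insert e t ⊆ B)
    (x : VertexModule R G s) :
    merge R hst (hr.rightInv R s (merge R (Finset.subset_insert e s) x)) =
      hr.rightInv R t (merge R (Finset.subset_insert e t) (merge R hst x)) := by
  have hs : insert e s ⊆ B := (Finset.insert_subset_insert e hst).trans ht
  simp only [IsRetraction.rightInv, dif_pos hs, dif_pos ht, merge_eq_push, push_push]
  congr 2
  funext c
  obtain ⟨v, rfl⟩ := Component.mk_surjective _ c
  rfl

lemma IsRetraction.rightInv_merge_eq_self (hr : IsRetraction B e r) (hid : ∀ x, r x = x)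
    {s : Finset E(G)}
    (hs : insert e s ⊆ B) (x : VertexModule R G s) :
    hr.rightInv R s (merge R (Finset.subset_insert e s) x) = x := by
  rw [IsRetraction.rightInv, dif_pos hs, merge_eq_push, push_push]
  refine push_id R _ (fun c => ?_) x
  obtain ⟨v, rfl⟩ := Component.mk_surjective _ c
  exact congrArg (Component.mk s) (hid v)

/-- Up to a coboundary, every family vanishes on the sets that contain `e`. -/
lemma IsRetraction.exists_totalD_eq (hr : IsRetraction B e r)
    (ψ : ∀ s : Finset E(G), VertexModule R G s) :
    ∃ ρ : ∀ s : Finset E(G), VertexModule R G s,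
      ∀ t ⊆ B, e ∈ t → totalD R ρ t = ψ t := by
  refine ⟨fun s => if e ∈ s then 0 else edgeSign R (insert e s) e •
    hr.rightInv R s (ψ (insert e s)), fun t ht he => ?_⟩
  obtain ⟨s, hs, rfl⟩ : ∃ s, e ∉ s ∧ insert e s = t :=
    ⟨t.erase e, Finset.notMem_erase e t, Finset.insert_erase he⟩
  rw [totalD_insert_of_vanish R _ hs]
  · rw [if_neg hs, map_smul, edgeSign_smul_smul, hr.merge_rightInv R ht]
  · intro f hf
    exact if_pos (mem_erase_insert hs hf)

lemma merge_eq_zero_of_totalD_eq_zero {e : E(G)} {χ : ∀ s : Finset E(G), VertexModule R G s}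
    (h0 : ∀ t ⊆ B, e ∈ t → χ t = 0) (hD : ∀ t ⊆ B, totalD R χ t = 0)
    {s : Finset E(G)} (hs : insert e s ⊆ B) (he : e ∉ s) :
    merge R (Finset.subset_insert e s) (χ s) = 0 := by
  have h := hD _ hs
  rw [totalD_insert_of_vanish R _ he] at h
  · rw [← edgeSign_smul_smul R (insert e s) e (merge R _ (χ s)), h, smul_zero]
  · intro f hf
    exact h0 _ ((Finset.erase_subset _ _).trans hs)
      (mem_erase_insert he hf)

/-- The complex of a graph with a loop is exact. -/
lemma IsRetraction.exact_of_eq_id (hr : IsRetraction B e r) (hid : ∀ x, r x = x) (heB : e ∈ B)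
    (ψ : ∀ s : Finset E(G), VertexModule R G s) (hψ : ∀ t ⊆ B, totalD R ψ t = 0) :
    ∃ η : ∀ s : Finset E(G), VertexModule R G s, ∀ t ⊆ B, totalD R η t = ψ t := by
  obtain ⟨ρ, hρ⟩ := hr.exists_totalD_eq R ψ
  refine ⟨ρ, fun t ht => ?_⟩
  by_cases he : e ∈ t
  · exact hρ t ht he
  have hs : insert e t ⊆ B := Finset.insert_subset heB ht
  have h := merge_eq_zero_of_totalD_eq_zero R (B := B) (e := e) (χ := ψ - totalD R ρ)
    (fun t ht he => by rw [Pi.sub_apply, hρ t ht he, sub_self])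
    (fun t ht => by rw [map_sub, totalD_totalD, sub_zero, hψ t ht]) hs he
  rw [← sub_eq_zero, ← neg_sub, neg_eq_zero, ← Pi.sub_apply,
    ← hr.rightInv_merge_eq_self R hid hs ((ψ - totalD R ρ) t), h, map_zero]

/-- Exactness in positive degree passes from the edge set `B \ {e}` to `B` along a retraction. -/
lemma IsRetraction.exact_pos (hr : IsRetraction B e r) (heB : e ∈ B)
    (ih : ∀ ψ : ∀ s : Finset E(G), VertexModule R G s, (∀ t ⊆ B.erase e, totalD R ψ t = 0) →
      ∃ η : ∀ s : Finset E(G), VertexModule R G s,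
        ∀ t ⊆ B.erase e, t.Nonempty → totalD R η t = ψ t)
    (ψ : ∀ s : Finset E(G), VertexModule R G s) (hψ : ∀ t ⊆ B, totalD R ψ t = 0) :
    ∃ η : ∀ s : Finset E(G), VertexModule R G s,
      ∀ t ⊆ B, t.Nonempty → totalD R η t = ψ t := by
  obtain ⟨ρ, hρ⟩ := hr.exists_totalD_eq R ψ
  set χ := ψ - totalD R ρ with hχ
  have hχe : ∀ t ⊆ B, e ∈ t → χ t = 0 := fun t ht he => by
    rw [hχ, Pi.sub_apply, hρ t ht he, sub_self]
  have hDχ : ∀ t ⊆ B, totalD R χ t = 0 := fun t ht => by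
    rw [hχ, map_sub, totalD_totalD, sub_zero, hψ t ht]
  obtain ⟨η', hη'⟩ := ih χ fun t ht => hDχ t (ht.trans (Finset.erase_subset e B))
  -- The correction of `η'` is killed by adding the edge `e`; it changes the coboundary on sets
  -- without `e` only by the image of `χ`, which is `0`.
  let p : ∀ s : Finset E(G), VertexModule R G s := fun s =>
    hr.rightInv R s (merge R (Finset.subset_insert e s) (η' s))
  let η : ∀ s : Finset E(G), VertexModule R G s := fun s => if e ∈ s then 0 else η' s - p s
  suffices h : ∀ t ⊆ B, t.Nonempty → totalD R η t = χ t by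
    refine ⟨ρ + η, fun t ht hne => ?_⟩
    rw [map_add, Pi.add_apply, h t ht hne, hχ, Pi.sub_apply, add_sub_cancel]
  intro t ht hne
  by_cases he : e ∈ t
  · obtain ⟨s, hs, rfl⟩ : ∃ s, e ∉ s ∧ insert e s = t :=
      ⟨t.erase e, Finset.notMem_erase e t, Finset.insert_erase he⟩
    rw [hχe _ ht he, totalD_insert_of_vanish R _ hs]
    · simp only [η, p, if_neg hs, map_sub, hr.merge_rightInv R ht, sub_self, smul_zero]
    · intro f hf
      exact if_pos (mem_erase_insert hs hf)
  · have hte : t ⊆ B.erase e := fun f hf => Finset.mem_erase.2 ⟨fun h => he (h ▸ hf), ht hf⟩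
    have hins : insert e t ⊆ B := Finset.insert_subset heB ht
    have h1 : totalD R η t = totalD R η' t - totalD R p t := by
      rw [← Pi.sub_apply, ← map_sub, totalD_apply, totalD_apply]
      refine Finset.sum_congr rfl fun f hf => ?_
      simp only [η, Pi.sub_apply]
      rw [if_neg fun h => he (Finset.mem_of_mem_erase h)]
    have h2 : totalD R p t =
        hr.rightInv R t (merge R (Finset.subset_insert e t) (totalD R η' t)) := by
      simp only [totalD_apply, map_sum, map_smul, p]
      exact Finset.sum_congr rfl fun f hf => by rw [hr.rightInv_merge R _ hins]
    rw [h1, h2, hη' t hte hne, merge_eq_zero_of_totalD_eq_zero R hχe hDχ hins he, map_zero,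
      sub_zero]

end Retraction

/-! ### Graphs with loops, and graphs without long cycles -/

section Forest

variable {α β : Type*} {G : Graph α β}

/-- The simple graph whose edges are the pairs of distinct vertices joined by an edge in `B`. -/
def simpleGraph (B : Finset E(G)) : SimpleGraph V(G) :=
  SimpleGraph.fromRel fun x y => ∃ e ∈ B, G.IsLink (e : β) (x : α) (y : α)

lemma simpleGraph_adj {B : Finset E(G)} {x y : V(G)} :
    (simpleGraph B).Adj x y ↔ x ≠ y ∧ ∃ e ∈ B, G.IsLink (e : β) (x : α) (y : α) := by
  simp only [simpleGraph, SimpleGraph.fromRel_adj]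
  refine and_congr_right fun _ => ⟨?_, Or.inl⟩
  rintro (h | ⟨e, he, h⟩)
  exacts [h, ⟨e, he, h.symm⟩]

lemma isAcyclic_simpleGraph (h : ¬ ∃ n : ℕ, 3 ≤ n ∧ HasCycle G n) (B : Finset E(G)) :
    (simpleGraph B).IsAcyclic := by
  rw [SimpleGraph.isAcyclic_iff_free_cycleGraph]
  rintro n hn ⟨f⟩
  refine h ⟨n, hn, by omega, ?_⟩
  obtain ⟨m, rfl⟩ : ∃ m, n = m + 3 := ⟨n - 3, by omega⟩
  have hadj : ∀ i : Fin (m + 3), (simpleGraph B).Adj (f i) (f (i + 1)) := fun i =>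
    f.toHom.map_rel (SimpleGraph.cycleGraph_adj.2 (Or.inr (by simp)))
  choose _ e _ he using fun i => simpleGraph_adj.1 (hadj i)
  refine ⟨fun i => f i, fun i => e i, fun i j hij => f.injective (Subtype.ext hij),
    fun i j hij => ?_, fun i => ?_⟩
  · have hl := he j
    simp only at hij
    rw [← hij] at hl
    rcases (he i).eq_and_eq_or_eq_and_eq hl with ⟨h1, -⟩ | ⟨h1, h2⟩
    · exact f.injective (Subtype.ext h1)
    · have h1 : i = j + 1 := f.injective (Subtype.ext h1)
      have h2 : i + 1 = j := f.injective (Subtype.ext h2)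
      -- Two edges with the same ends would give `2 = 0` modulo the length of the cycle.
      subst h1
      rw [add_assoc, add_eq_left] at h2
      have := congrArg Fin.val h2
      simp [Fin.val_add] at this
      rw [Nat.mod_eq_of_lt (by omega)] at this
      omega
  · rw [finRotate_apply]
    exact he i

/-- In a loopless graph without cycles of length at least `3`, every non-empty finite set of edges
admits a retraction along one of its edges: some vertex has exactly one neighbour. -/
lemma exists_isRetraction [Finite V(G)] (hG : G.Loopless)
    (h : ¬ ∃ n : ℕ, 3 ≤ n ∧ HasCycle G n) {B : Finset E(G)} (hB : B.Nonempty) :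
    ∃ e ∈ B, ∃ r : V(G) → V(G), IsRetraction B e r := by
  classical
  have hac := isAcyclic_simpleGraph h B
  obtain ⟨e₀, he₀⟩ := hB
  obtain ⟨x₀, y₀, hl₀⟩ := G.exists_isLink_of_mem_edgeSet e₀.2
  let x : V(G) := ⟨x₀, hl₀.left_mem⟩
  let y : V(G) := ⟨y₀, hl₀.right_mem⟩
  have hxy : (simpleGraph B).Adj x y :=
    simpleGraph_adj.2 ⟨fun h => hl₀.ne (congrArg Subtype.val h), e₀, he₀, hl₀⟩
  have : Nonempty V(G) := ⟨x⟩
  obtain ⟨u, v, p, hp, hmax⟩ :=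
    SimpleGraph.Walk.exists_isPath_forall_isPath_length_le_length (simpleGraph B)
  have hnil : ¬ p.Nil := fun hn => by
    have h1 := hmax x y hxy.toWalk (SimpleGraph.Path.singleton hxy).2
    rw [SimpleGraph.Walk.length_eq_zero_iff.2 hn] at h1
    simp at h1
  have huw := p.adj_snd hnil
  -- An end of a longest path has only one neighbour.
  have hu : ∀ w, (simpleGraph B).Adj u w → w = p.snd := fun w hadj => by
    refine hac.eq_snd_of_adj_start hp hadj ?_
    by_contra hw
    have h1 := hmax w v (p.cons hadj.symm) (hp.cons hw)
    simp at h1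
  obtain ⟨hne, e, he, hl⟩ := simpleGraph_adj.1 huw
  refine ⟨e, he, fun x => if x = u then p.snd else x, ?_, ?_, ?_⟩
  · intro x
    by_cases hx : x = u
    · subst hx; rw [if_pos rfl]; exact Or.inr hl
    · exact Or.inl (if_neg hx)
  · intro x y hxy
    rcases hl.eq_and_eq_or_eq_and_eq hxy with ⟨h1, h2⟩ | ⟨h1, h2⟩
    · rw [← Subtype.ext h1, ← Subtype.ext h2, if_pos rfl, if_neg hne.symm]
    · rw [← Subtype.ext h1, ← Subtype.ext h2, if_pos rfl, if_neg hne.symm]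
  · intro f hf x y hxy
    have hloop : x ≠ y := fun h => hxy.ne (congrArg Subtype.val h)
    by_cases hx : x = u
    · subst hx
      have := hu y (simpleGraph_adj.2 ⟨hloop, f, hf, hxy⟩)
      left
      rw [if_pos rfl, if_neg hloop.symm, this]
    by_cases hy : y = u
    · subst hy
      have := hu x (simpleGraph_adj.2 ⟨hloop.symm, f, hf, hxy.symm⟩)
      left
      rw [if_pos rfl, if_neg hloop, this]
    · exact Or.inr ⟨if_neg hx, if_neg hy⟩

variable (R : Type*) [CommRing R] [Finite V(G)] [LinearOrder E(G)]

/-- If `G` has no loops and no cycles of length at least `3`, every cocycle is a coboundary in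
positive degrees, that is, on non-empty sets of edges. -/
lemma exact_pos_of_no_cycle (hG : G.Loopless) (h : ¬ ∃ n : ℕ, 3 ≤ n ∧ HasCycle G n)
    (B : Finset E(G)) : ∀ ψ : ∀ s : Finset E(G), VertexModule R G s,
      (∀ t ⊆ B, totalD R ψ t = 0) → ∃ η : ∀ s : Finset E(G), VertexModule R G s,
        ∀ t ⊆ B, t.Nonempty → totalD R η t = ψ t := by
  induction B using Finset.strongInduction with
  | H B ih =>
    intro ψ hψ
    rcases B.eq_empty_or_nonempty with rfl | hB
    · exact ⟨0, fun t ht hne => absurd (Finset.subset_empty.1 ht) hne.ne_empty⟩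
    obtain ⟨e, he, r, hr⟩ := exists_isRetraction hG h hB
    exact hr.exact_pos R he (ih _ (Finset.erase_ssubset he)) ψ hψ

/-- If `G` has a loop, the identity of the vertices is a retraction along it, and every cocycle is a
coboundary. -/
lemma exact_of_not_loopless [Finite E(G)] (hG : ¬ G.Loopless)
    (ψ : ∀ s : Finset E(G), VertexModule R G s) (hψ : totalD R ψ = 0) :
    ∃ η : ∀ s : Finset E(G), VertexModule R G s, totalD R η = ψ := by
  have := Fintype.ofFinite E(G)
  obtain ⟨e, x, hl⟩ : ∃ e x, G.IsLoopAt e x := by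
    by_contra! hn
    exact hG ⟨hn⟩
  have hr : IsRetraction Finset.univ (⟨e, Graph.IsLink.edge_mem hl⟩ : E(G)) id := by
    refine ⟨fun _ => Or.inl rfl, fun y z hyz => Subtype.ext ?_, fun _ _ _ _ _ => Or.inr ⟨rfl, rfl⟩⟩
    rcases Graph.IsLink.eq_and_eq_or_eq_and_eq hl hyz with ⟨h1, h2⟩ | ⟨h1, h2⟩
    · exact h1.symm.trans h2
    · exact h2.symm.trans h1
  obtain ⟨η, hη⟩ := hr.exact_of_eq_id R (fun _ => rfl) (Finset.mem_univ _) ψ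
    (fun t _ => congrFun hψ t)
  exact ⟨η, funext fun t => hη t (Finset.subset_univ t)⟩

lemma coboundaries_eq_ker_of_exact
    (h : ∀ ψ : ∀ s : Finset E(G), VertexModule R G s, totalD R ψ = 0 →
      ∃ η : ∀ s : Finset E(G), VertexModule R G s, ∀ t, t.Nonempty → totalD R η t = ψ t)
    (i : ℕ) (ψ : Cochain R G (i + 1)) (hψ : d R G (i + 1) ψ = 0) :
    ψ ∈ coboundaries R G (i + 1) := by
  obtain ⟨η, hη⟩ := h (extendZero R ψ) (funext fun t => by
    by_cases ht : t.card = i + 1 + 1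
    · rw [← d_eq_totalD R ψ ⟨t, ht⟩, hψ]; rfl
    · exact totalD_extendZero_of_ne R ψ ht)
  refine ⟨fun s => η s.1, funext fun t => ?_⟩
  rw [d_restrict, hη t.1 (Finset.card_pos.1 (by rw [t.2]; omega)), extendZero_of_card R ψ t.2]

end Forest

/-! ### Coefficients in `R[x]/(x²)` -/

section Algebra

variable (R : Type*) [CommRing R]

instance : Module.Free R (A2 R) := (Polynomial.monic_X_pow 2).free_adjoinRoot

/-- The class of the variable in `R[x]/(x²)`. -/
def A2.x : A2 R := AdjoinRoot.root _

lemma A2.x_mul_x : A2.x R * A2.x R = 0 := by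
  rw [← sq]
  exact (Polynomial.eval₂_X_pow ..).symm.trans (AdjoinRoot.eval₂_root (Polynomial.X ^ 2 : R[X]))

/-- The homomorphism from `R[x]/(x²)` to the dual numbers that takes `x` to `ε`. -/
def A2.toDualNumber : A2 R →ₐ[R] DualNumber R :=
  AdjoinRoot.liftAlgHom _ (Algebra.ofId R _) DualNumber.eps (by simp [sq])

/-- The coefficient of `1`. -/
def A2.coeffOne : A2 R →ₗ[R] R :=
  (TrivSqZeroExt.fstHom R R R).toLinearMap ∘ₗ (A2.toDualNumber R).toLinearMap

/-- The coefficient of `x`. -/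
def A2.coeffX : A2 R →ₗ[R] R :=
  TrivSqZeroExt.sndHom R R ∘ₗ (A2.toDualNumber R).toLinearMap

lemma A2.coeffX_mul (a b : A2 R) :
    A2.coeffX R (a * b) = A2.coeffOne R a * A2.coeffX R b + A2.coeffOne R b * A2.coeffX R a := by
  simp [A2.coeffX, A2.coeffOne, mul_comm]

@[simp] lemma A2.coeffX_x : A2.coeffX R (A2.x R) = 1 := by
  simp [A2.coeffX, A2.toDualNumber, A2.x]

@[simp] lemma A2.coeffOne_x : A2.coeffOne R (A2.x R) = 0 := by
  simp [A2.coeffOne, A2.toDualNumber, A2.x]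

@[simp] lemma A2.coeffX_one : A2.coeffX R 1 = 0 := by
  simp [A2.coeffX]

@[simp] lemma A2.coeffOne_one : A2.coeffOne R 1 = 1 := by
  simp [A2.coeffOne]

end Algebra

/-! ### Distinguished elements and their coefficients -/

section Elements

variable (R : Type*) [CommRing R] {α β : Type*} {G : Graph α β}

instance [Finite V(G)] (s : Finset E(G)) : Module.Free R (VertexModule R G s) :=
  Module.Free.of_basis
    (Basis.piTensorProduct fun _ : Component G s => Module.Free.chooseBasis R (A2 R))

/-- The tensor product of one factor `x` for each component. -/
def topElem (s : Finset E(G)) : VertexModule R G s := PiTensorProduct.tprod R fun _ => A2.x R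

open Classical in
/-- The tensor product that has the factor `1` at the component `c` and `x` at the others. -/
def markElem (s : Finset E(G)) (c : Component G s) : VertexModule R G s :=
  PiTensorProduct.tprod R fun b => if b = c then 1 else A2.x R

variable [Finite V(G)]

/-- The sum over all components of the tensor products with one factor `1` there and all other
factors `x`. Modulo `2`, it is the image of `topElem` under the derivation `d/dx`. -/
def sumMark (s : Finset E(G)) : VertexModule R G s := ∑ c, markElem R s c

/-- The coefficient of `topElem`. -/
def topCoeff (s : Finset E(G)) : VertexModule R G s →ₗ[R] R :=
  PiTensorProduct.lift ((MultilinearMap.mkPiAlgebra R (Component G s) R).compLinearMap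
    fun _ => A2.coeffX R)

open Classical in
/-- The coefficient of `markElem c`. -/
def markCoeff (s : Finset E(G)) (c : Component G s) : VertexModule R G s →ₗ[R] R :=
  PiTensorProduct.lift ((MultilinearMap.mkPiAlgebra R (Component G s) R).compLinearMap
    fun b => if b = c then A2.coeffOne R else A2.coeffX R)

lemma topCoeff_tprod (s : Finset E(G)) (a : Component G s → A2 R) :
    topCoeff R s (PiTensorProduct.tprod R a) = ∏ b, A2.coeffX R (a b) := by
  simp [topCoeff]

open Classical in
lemma markCoeff_tprod (s : Finset E(G)) (c : Component G s) (a : Component G s → A2 R) :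
    markCoeff R s c (PiTensorProduct.tprod R a) =
      A2.coeffOne R (a c) * ∏ b ∈ Finset.univ.erase c, A2.coeffX R (a b) := by
  simp only [markCoeff, PiTensorProduct.lift.tprod, MultilinearMap.compLinearMap_apply,
    MultilinearMap.mkPiAlgebra_apply]
  rw [← Finset.mul_prod_erase _ _ (Finset.mem_univ c), if_pos rfl]
  congr 1
  exact Finset.prod_congr rfl fun b hb => by rw [if_neg (Finset.ne_of_mem_erase hb)]

lemma markCoeff_sumMark (s : Finset E(G)) (c : Component G s) :
    markCoeff R s c (sumMark R s) = 1 := by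
  classical
  rw [sumMark, map_sum, Finset.sum_eq_single c]
  · rw [markElem, markCoeff_tprod, if_pos rfl, A2.coeffOne_one, one_mul]
    refine Finset.prod_eq_one fun b hb => ?_
    rw [if_neg (Finset.ne_of_mem_erase hb), A2.coeffX_x]
  · intro b _ hb
    rw [markElem, markCoeff_tprod, if_neg hb.symm, A2.coeffOne_x, zero_mul]
  · exact fun h => absurd (Finset.mem_univ c) h

lemma topElem_mem_homogeneous (s : Finset E(G)) :
    topElem R s ∈ VertexModule.homogeneous R G s (Fintype.card (Component G s)) :=
  Submodule.subset_span ⟨fun _ => 1, fun _ => A2.x R,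
    fun _ => Submodule.subset_span (by simp [A2.x]), by simp, rfl⟩

lemma sumMark_mem_homogeneous (s : Finset E(G)) :
    sumMark R s ∈ VertexModule.homogeneous R G s (Fintype.card (Component G s) - 1) := by
  classical
  refine Submodule.sum_mem _ fun c _ => Submodule.subset_span
    ⟨fun b => if b = c then 0 else 1, _, fun b => Submodule.subset_span ?_, ?_, rfl⟩
  · by_cases h : b = c
    · simp [h]
    · simp [h, A2.x]
  · rw [← Finset.add_sum_erase _ _ (Finset.mem_univ c), if_pos rfl, zero_add,
      Finset.sum_congr rfl fun b hb => if_neg (Finset.ne_of_mem_erase hb)]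
    simp

end Elements

/-! ### Per-edge maps on the distinguished elements -/

section Joining

variable {α β : Type*} {G : Graph α β}

/-- The map `f` of components is surjective, and the only two different components that it
identifies are `p` and `q`. -/
structure Joins {s t : Finset E(G)} (f : Component G s → Component G t) (p q : Component G s) :
    Prop where
  ne : p ≠ q
  surjective : Function.Surjective f
  eq_iff : ∀ b b', f b = f b' ↔ b = b' ∨ (b = p ∧ b' = q) ∨ (b = q ∧ b' = p)

lemma Component.incl_surjective {s t : Finset E(G)} (h : s ⊆ t) :
    Function.Surjective (Component.incl h) := fun c => by
  obtain ⟨v, rfl⟩ := Component.mk_surjective _ c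
  exact ⟨Component.mk s v, rfl⟩

lemma Component.incl_eq_iff {s t : Finset E(G)} (hst : s ⊆ t) {e : E(G)} (he : e ∈ t)
    (ht : ∀ f ∈ t, f ≠ e → f ∈ s) {u w : V(G)} (hl : G.IsLink (e : β) (u : α) (w : α))
    (b b' : Component G s) :
    Component.incl hst b = Component.incl hst b' ↔ b = b' ∨
      (b = Component.mk s u ∧ b' = Component.mk s w) ∨
      (b = Component.mk s w ∧ b' = Component.mk s u) := by
  classical
  constructor
  · intro h
    -- The map that takes the component of `w` to that of `u` factors through the components
    -- of `[G : t]`.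
    let r : V(G) → Component G s := fun x =>
      if Component.mk s x = Component.mk s w then Component.mk s u else Component.mk s x
    have hr : ∀ f ∈ t, ∀ x y : V(G), G.IsLink (f : β) (x : α) (y : α) → r x = r y := by
      intro f hf x y hxy
      by_cases hfe : f = e
      · subst hfe
        rcases hl.eq_and_eq_or_eq_and_eq hxy with ⟨h1, h2⟩ | ⟨h1, h2⟩ <;>
        · rw [← Subtype.ext h1, ← Subtype.ext h2]
          simp [r]
      · simp only [r, Component.mk_eq (ht f hf hfe) hxy]
    have key : ∀ c : Component G s, Component.lift r hr (Component.incl hst c) =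
        if c = Component.mk s w then Component.mk s u else c := fun c => by
      obtain ⟨v, rfl⟩ := Component.mk_surjective _ c
      rfl
    have h' := congrArg (Component.lift r hr) h
    rw [key, key] at h'
    split_ifs at h' with h1 h2 h2
    · exact Or.inl (h1.trans h2.symm)
    · exact Or.inr (Or.inr ⟨h1, h'.symm⟩)
    · exact Or.inr (Or.inl ⟨h', h2⟩)
    · exact Or.inl h'
  · have h : Component.mk t u = Component.mk t w := Component.mk_eq he hl
    rintro (rfl | ⟨rfl, rfl⟩ | ⟨rfl, rfl⟩)
    exacts [rfl, h, h.symm]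

lemma Component.joins_incl {s t : Finset E(G)} (hst : s ⊆ t) {e : E(G)} (he : e ∈ t)
    (ht : ∀ f ∈ t, f ≠ e → f ∈ s) {u w : V(G)} (hl : G.IsLink (e : β) (u : α) (w : α))
    (hne : Component.mk s u ≠ Component.mk s w) :
    Joins (Component.incl hst) (Component.mk s u) (Component.mk s w) :=
  ⟨hne, Component.incl_surjective hst, Component.incl_eq_iff hst he ht hl⟩

lemma Component.incl_bijective {s t : Finset E(G)} (hst : s ⊆ t) {e : E(G)} (he : e ∈ t)
    (ht : ∀ f ∈ t, f ≠ e → f ∈ s) {u w : V(G)} (hl : G.IsLink (e : β) (u : α) (w : α))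
    (heq : Component.mk s u = Component.mk s w) : Function.Bijective (Component.incl hst) := by
  refine ⟨fun b b' h => ?_, Component.incl_surjective hst⟩
  rcases (Component.incl_eq_iff hst he ht hl b b').1 h with h | ⟨h, h'⟩ | ⟨h, h'⟩
  · exact h
  · rw [h, h', heq]
  · rw [h, h', heq]

lemma Component.mk_empty_bijective : Function.Bijective (Component.mk (∅ : Finset E(G))) :=
  ⟨fun _ _ h => congrArg
    (Component.lift (s := ∅) id fun _ h _ _ _ => absurd h (Finset.notMem_empty _)) h,
    Component.mk_surjective _⟩

/-- Two vertices are in one component of the spanning subgraph with the single edge `f` if and only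
if they are equal or the ends of `f`. -/
lemma Component.mk_singleton_eq_iff {f : E(G)} {x y : V(G)} :
    Component.mk {f} x = Component.mk {f} y ↔ x = y ∨ G.IsLink (f : β) (x : α) (y : α) := by
  obtain ⟨u, w, hl⟩ := G.exists_isLink_of_mem_edgeSet f.2
  have h := Component.incl_eq_iff (s := ∅) (Finset.empty_subset {f}) (Finset.mem_singleton_self f)
    (fun g hg hgf => absurd (Finset.mem_singleton.1 hg) hgf)
    (u := ⟨u, hl.left_mem⟩) (w := ⟨w, hl.right_mem⟩) hl (Component.mk ∅ x) (Component.mk ∅ y)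
  simp only [Component.incl_mk, Component.mk_empty_bijective.injective.eq_iff] at h
  rw [h, hl.isLink_iff, Subtype.ext_iff, Subtype.ext_iff, Subtype.ext_iff, Subtype.ext_iff]
  grind

namespace Joins

variable {s t : Finset E(G)} {f : Component G s → Component G t} {p q : Component G s}
  (hf : Joins f p q)
include hf

lemma injOn : Set.InjOn f {q}ᶜ := fun b hb b' hb' h => by
  rcases (hf.eq_iff b b').1 h with h | ⟨h, h'⟩ | ⟨h, h'⟩
  exacts [h, absurd h' hb', absurd h hb]

lemma apply_eq : f p = f q := (hf.eq_iff p q).2 (Or.inr (Or.inl ⟨rfl, rfl⟩))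

variable [Finite V(G)]

open Classical in
lemma image_erase : (Finset.univ.erase q).image f = Finset.univ := by
  refine Finset.eq_univ_of_forall fun c => ?_
  obtain ⟨b, rfl⟩ := hf.surjective c
  by_cases hb : b = q
  · exact Finset.mem_image.2 ⟨p, by simp [hf.ne], by rw [hb, hf.apply_eq]⟩
  · exact Finset.mem_image_of_mem _ (by simp [hb])

lemma card : Fintype.card (Component G t) + 1 = Fintype.card (Component G s) := by
  classical
  rw [← Finset.card_univ, ← hf.image_erase, Finset.card_image_of_injOn, Finset.card_erase_add_one,
    Finset.card_univ]
  · exact Finset.mem_univ q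
  · exact hf.injOn.mono fun b hb => by simpa using hb

open Classical in
lemma prod_fiber {M : Type*} [CommMonoid M] (a : Component G s → M) :
    ∏ b with f b = f p, a b = a p * a q := by
  rw [← Finset.prod_pair hf.ne]
  refine Finset.prod_congr ?_ fun _ _ => rfl
  ext b
  simp only [Finset.mem_filter, Finset.mem_univ, true_and, hf.eq_iff, Finset.mem_insert,
    Finset.mem_singleton]
  tauto

open Classical in
lemma prod_fiber_of_ne {M : Type*} [CommMonoid M] (a : Component G s → M) {b : Component G s}
    (hp : b ≠ p) (hq : b ≠ q) : ∏ b' with f b' = f b, a b' = a b := by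
  rw [Finset.prod_eq_single b]
  · intro b' hb' hne
    rcases (hf.eq_iff b' b).1 (Finset.mem_filter.1 hb').2 with h | ⟨h, h'⟩ | ⟨h, h'⟩
    exacts [absurd h hne, absurd h' hq, absurd h' hp]
  · simp

variable (R : Type*) [CommRing R]

/-- The only terms that contribute to the coefficient of `topElem` after two components have been
joined are those with the factor `1` at one of these components and `x` everywhere else. -/
lemma topCoeff_push (y : VertexModule R G s) :
    topCoeff R t (push R f y) = markCoeff R s p y + markCoeff R s q y := by
  classical
  suffices h : topCoeff R t ∘ₗ push R f = markCoeff R s p + markCoeff R s q from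
    LinearMap.congr_fun h y
  refine PiTensorProduct.ext (MultilinearMap.ext fun a => ?_)
  simp only [LinearMap.compMultilinearMap_apply, LinearMap.comp_apply, LinearMap.add_apply,
    push_tprod, topCoeff_tprod, markCoeff_tprod]
  rw [← hf.image_erase, Finset.prod_image (hf.injOn.mono fun b hb => by simpa using hb),
    ← Finset.mul_prod_erase (Finset.univ.erase q) _ (show p ∈ _ by simp [hf.ne]),
    ← Finset.mul_prod_erase (Finset.univ.erase q) (fun b => A2.coeffX R (a b))
      (show p ∈ _ by simp [hf.ne]),
    ← Finset.mul_prod_erase (Finset.univ.erase p) (fun b => A2.coeffX R (a b))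
      (show q ∈ _ by simp [hf.ne.symm]), Finset.erase_right_comm (a := p), hf.prod_fiber,
    A2.coeffX_mul]
  have : ∏ b ∈ (Finset.univ.erase q).erase p, A2.coeffX R (∏ b' with f b' = f b, a b') =
      ∏ b ∈ (Finset.univ.erase q).erase p, A2.coeffX R (a b) := by
    refine Finset.prod_congr rfl fun b hb => ?_
    simp only [Finset.mem_erase, Finset.mem_univ, and_true] at hb
    rw [hf.prod_fiber_of_ne a hb.1 hb.2]
  rw [this]
  ring

lemma push_markElem_of_eq {c : Component G s} (hc : c = p ∨ c = q) :
    push R f (markElem R s c) = topElem R t := by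
  classical
  rw [markElem, push_tprod, topElem]
  refine congrArg _ (funext fun c' => ?_)
  obtain ⟨b, rfl⟩ := hf.surjective c'
  by_cases hb : b = p ∨ b = q
  · have : f b = f p := by rcases hb with rfl | rfl; exacts [rfl, hf.apply_eq.symm]
    rw [this, hf.prod_fiber]
    rcases hc with rfl | rfl
    · simp [hf.ne.symm]
    · simp [hf.ne]
  · rw [not_or] at hb
    rw [hf.prod_fiber_of_ne _ hb.1 hb.2, if_neg]
    rintro rfl
    tauto

lemma push_markElem_of_ne {c : Component G s} (hp : c ≠ p) (hq : c ≠ q) :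
    push R f (markElem R s c) = 0 := by
  classical
  rw [markElem, push_tprod]
  refine MultilinearMap.map_coord_zero _ (f p) ?_
  rw [hf.prod_fiber, if_neg hp.symm, if_neg hq.symm, A2.x_mul_x]

lemma push_sumMark : push R f (sumMark R s) = (2 : R) • topElem R t := by
  classical
  rw [sumMark, map_sum, ← Finset.sum_subset (Finset.subset_univ {p, q}), Finset.sum_pair hf.ne,
    hf.push_markElem_of_eq R (Or.inl rfl), hf.push_markElem_of_eq R (Or.inr rfl), two_smul]
  intro c _ hc
  simp only [Finset.mem_insert, Finset.mem_singleton, not_or] at hc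
  exact hf.push_markElem_of_ne R hc.1 hc.2

end Joins

lemma push_sumMark_of_bijective [Finite V(G)] (R : Type*) [CommRing R] {s t : Finset E(G)}
    {f : Component G s → Component G t} (hf : Function.Bijective f) :
    push R f (sumMark R s) = sumMark R t := by
  classical
  rw [sumMark, sumMark, map_sum]
  refine Fintype.sum_bijective f hf _ _ fun c => ?_
  rw [markElem, push_tprod, markElem]
  refine congrArg _ (funext fun c' => ?_)
  obtain ⟨b, rfl⟩ := hf.surjective c'
  rw [Finset.prod_eq_single b]
  · simp [hf.injective.eq_iff]
  · intro b' hb' hne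
    exact absurd (hf.injective (Finset.mem_filter.1 hb').2) hne
  · simp

lemma card_component_empty [Finite V(G)] :
    Fintype.card (Component G (∅ : Finset E(G))) = Nat.card V(G) := by
  rw [← Nat.card_eq_fintype_card]
  exact (Nat.card_congr (Equiv.ofBijective _ Component.mk_empty_bijective)).symm

end Joining

/-! ### Alternating sums over cyclic index sets -/

section CycleIndices

lemma finRotate_finRotate_ne {n : ℕ} (hn : 3 ≤ n) (i : Fin n) :
    finRotate n (finRotate n i) ≠ i := by
  obtain ⟨m, rfl⟩ : ∃ m, n = m + 3 := ⟨n - 3, by omega⟩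
  rw [finRotate_apply, finRotate_apply, add_assoc, Ne, add_eq_left]
  intro h
  have := congrArg Fin.val h
  simp only [Fin.val_add, Fin.val_one, Fin.val_zero] at this
  rw [Nat.mod_eq_of_lt (by omega)] at this
  omega

/-- Going once around an odd cycle shows that `a i = -a i`. -/
lemma eq_zero_of_add_finRotate_eq_zero {n : ℕ} (hn : Odd n) (a : Fin n → ℤ)
    (ha : ∀ i, a i + a (finRotate n i) = 0) (i : Fin n) : a i = 0 := by
  obtain ⟨m, rfl⟩ : ∃ m, n = m + 1 := ⟨n - 1, by have := hn.pos; omega⟩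
  have hm : Even m := by
    rw [Nat.odd_add_one, Nat.not_odd_iff_even] at hn
    exact hn
  have key : ∀ k (hk : k < m + 1), a ⟨k, hk⟩ = (-1) ^ k * a 0 := by
    intro k
    induction k with
    | zero => intro hk; simp
    | succ k ih =>
      intro hk
      have h := ha ⟨k, by omega⟩
      rw [finRotate_of_lt (by omega), ih] at h
      rw [pow_succ]
      linarith
  have h0 : a 0 = 0 := by
    have h := ha (Fin.last m)
    rw [finRotate_last] at h
    have h' := key m (by omega)
    rw [hm.neg_one_pow, one_mul] at h'
    have : a (Fin.last m) = a 0 := h'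
    omega
  rw [← Fin.eta i i.2, key i.1 i.2, h0, mul_zero]

/-- For an even cyclic index set there is an alternating sign, and so the alternating sum of
`a i + a (i + 1)` vanishes. -/
lemma sum_alternating_eq_zero {n : ℕ} (hn : Even n) (a : Fin n → ℤ) :
    ∑ i : Fin n, (-1) ^ (i : ℕ) * (a i + a (finRotate n i)) = 0 := by
  have hsign : ∀ i : Fin n, (-1 : ℤ) ^ (i : ℕ) = -(-1) ^ (finRotate n i : ℕ) := by
    rcases n with _ | m
    · exact fun i => i.elim0
    · intro i
      rcases Fin.eq_castSucc_or_eq_last i with ⟨j, rfl⟩ | rfl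
      · have : finRotate (m + 1) j.castSucc = j.succ := by
          rw [finRotate_apply, Fin.coeSucc_eq_succ]
        rw [this, Fin.val_succ, Fin.val_castSucc, pow_succ]
        ring
      · rw [finRotate_last, Fin.val_last, Fin.val_zero, pow_zero]
        rw [Nat.even_add_one, Nat.not_even_iff_odd] at hn
        exact hn.neg_one_pow
  have h : ∑ i : Fin n, (-1) ^ (i : ℕ) * a (finRotate n i) =
      -∑ i : Fin n, (-1) ^ (i : ℕ) * a i := by
    rw [← Equiv.sum_comp (finRotate n) fun i : Fin n => (-1) ^ (i : ℕ) * a i,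
      ← Finset.sum_neg_distrib]
    exact Finset.sum_congr rfl fun i _ => by rw [hsign i]; ring
  simp only [mul_add, Finset.sum_add_distrib]
  rw [h, add_neg_cancel]

/-- The parity argument for even cycles. The alternating sum over `i` and `j` of
`p i j + p i (j + 1)` vanishes; its diagonal terms are `2 * p i i`, and its other terms are even and
come in equal pairs. Hence `∑ p i i` is even. -/
lemma even_sum_of_symmetric {n : ℕ} (hn : Even n) (p : Fin n → Fin n → ℤ) (τ : Fin n → ℤ)
    (hdiag : ∀ i, p i (finRotate n i) = p i i)
    (hsymm : ∀ i j, i ≠ j → p i j + p i (finRotate n j) = p j i + p j (finRotate n i))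
    (hτ : ∀ i k, ∃ m, p i k = τ i + 2 * m) : Even (∑ i, τ i) := by
  choose m hm using hτ
  let h : Fin n → Fin n → ℤ := fun i j => τ i + m i j + m i (finRotate n j)
  have hh : ∀ i j, p i j + p i (finRotate n j) = 2 * h i j := fun i j => by
    rw [hm i j, hm i (finRotate n j)]; simp only [h]; ring
  have hs : ∀ i j, h i j = h j i := fun i j => by
    by_cases hij : i = j
    · rw [hij]
    · have := hsymm i j hij
      rw [hh, hh] at this
      omega
  have hzero : ∑ i : Fin n, ∑ j : Fin n, (-1) ^ (i : ℕ) * ((-1) ^ (j : ℕ) * h i j) = 0 := by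
    refine Finset.sum_eq_zero fun i _ => ?_
    rw [← Finset.mul_sum]
    have h2 := sum_alternating_eq_zero hn (p i)
    simp only [hh, mul_left_comm _ (2 : ℤ)] at h2
    rw [← Finset.mul_sum] at h2
    rw [show ∑ j : Fin n, (-1) ^ (j : ℕ) * h i j = 0 by omega, mul_zero]
  have hcast := congrArg (Int.cast : ℤ → ZMod 2) hzero
  push_cast at hcast
  have hone : (-1 : ZMod 2) = 1 := by decide
  simp only [hone, one_pow, one_mul] at hcast
  rw [← Finset.sum_product', ← Finset.sum_filter_add_sum_filter_not _ fun x => x.1 = x.2] at hcast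
  have hoff : ∑ x ∈ (Finset.univ ×ˢ Finset.univ : Finset (Fin n × Fin n)) with ¬ x.1 = x.2,
      (h x.1 x.2 : ZMod 2) = 0 := by
    refine Finset.sum_involution (fun x _ => (x.2, x.1)) ?_ ?_ ?_ ?_
    · intro x _
      rw [hs x.2 x.1]
      exact CharTwo.add_self_eq_zero _
    · intro x hx _ heq
      exact (Finset.mem_filter.1 hx).2 (congrArg Prod.snd heq)
    · intro x hx
      simp only [Finset.mem_filter, Finset.mem_product, Finset.mem_univ, true_and] at hx ⊢
      exact fun h => hx h.symm
    · intro x _; rfl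
  rw [hoff, add_zero, Finset.sum_filter, Finset.sum_product] at hcast
  simp only [Finset.sum_ite_eq, Finset.mem_univ, if_true] at hcast
  rw [← ZMod.intCast_eq_zero_iff_even]
  push_cast
  rw [← hcast]
  refine Finset.sum_congr rfl fun i _ => ?_
  have : 2 * h i i = 2 * p i i := by rw [← hh i i, hdiag i]; ring
  rw [show h i i = τ i + 2 * m i i by rw [← hm i i]; omega]
  push_cast
  rw [show (2 : ZMod 2) = 0 by decide]
  ring

end CycleIndices

/-! ### Spanning subgraphs with one edge -/

section SmallEdgeSets

variable {α β : Type*} {G : Graph α β}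

lemma mk_singleton_ne [G.Loopless] {e f : E(G)} {u w : V(G)} (hl : G.IsLink (e : β) (u : α) (w : α))
    (h : ¬ G.IsLink (f : β) (u : α) (w : α)) : Component.mk {f} u ≠ Component.mk {f} w := by
  rw [Ne, Component.mk_singleton_eq_iff, not_or]
  exact ⟨fun h => hl.ne (congrArg Subtype.val h), h⟩

lemma not_isLink_of_ne {n : ℕ} (hn : 3 ≤ n) {v : Fin n → α} {e : Fin n → β}
    (hv : Function.Injective v) (he : ∀ i, G.IsLink (e i) (v i) (v (finRotate n i)))
    {i j : Fin n} (hij : i ≠ j) : ¬ G.IsLink (e i) (v j) (v (finRotate n j)) := fun h => by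
  rcases (he i).eq_and_eq_or_eq_and_eq h with ⟨h1, -⟩ | ⟨h1, h2⟩
  · exact hij (hv h1)
  · have h1 := hv h1
    have h2 := hv h2
    rw [h1] at h2
    exact finRotate_finRotate_ne hn j h2

open Classical in
/-- The indicator function of the sets of edges that contain an edge between `a` and `b`. -/
def linkIndicator (a b : α) (s : Finset E(G)) : ℤ :=
  if ∃ f ∈ s, G.IsLink (f : β) a b then 1 else 0

open Classical in
lemma linkIndicator_congr {a b x y : α} {f g : E(G)} (hf : G.IsLink (f : β) x y)
    (hg : G.IsLink (g : β) x y) : linkIndicator a b {f} = linkIndicator a b {g} :=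
  if_congr (by simp only [Finset.mem_singleton, exists_eq_left, hf.isLink_iff, hg.isLink_iff])
    rfl rfl

variable [Finite V(G)]

lemma card_component_singleton [G.Loopless] (e : E(G)) :
    Fintype.card (Component G {e}) = Nat.card V(G) - 1 := by
  obtain ⟨u, w, hl⟩ := G.exists_isLink_of_mem_edgeSet e.2
  have h := (Component.joins_incl (Finset.empty_subset {e}) (Finset.mem_singleton_self e)
    (fun g hg hge => absurd (Finset.mem_singleton.1 hg) hge)
    (u := ⟨u, hl.left_mem⟩) (w := ⟨w, hl.right_mem⟩) hl
    (Component.mk_empty_bijective.injective.ne fun h => hl.ne (congrArg Subtype.val h))).card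
  rw [card_component_empty] at h
  omega

/-- For a family `F` of elements, the coefficient in `F s` of the element that has the factor `1` at
the component of the vertex `x` and the factor `x` at all other components. -/
def markCoeffAt (F : ∀ s : Finset E(G), VertexModule ℤ G s) (s : Finset E(G)) (x : V(G)) : ℤ :=
  markCoeff ℤ s (Component.mk s x) (F s)

lemma markCoeffAt_congr (F : ∀ s : Finset E(G), VertexModule ℤ G s) {s : Finset E(G)} {x y : V(G)}
    (h : Component.mk s x = Component.mk s y) : markCoeffAt F s x = markCoeffAt F s y := by
  rw [markCoeffAt, markCoeffAt, h]

end SmallEdgeSets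

/-! ### Sets of two edges -/

section Pairs

variable {α β : Type*} {G : Graph α β} [LinearOrder E(G)]

lemma edgeSign_singleton (R : Type*) [CommRing R] (e : E(G)) : edgeSign R {e} e = 1 := by
  simp [edgeSign]

lemma erase_pair_left {e f : E(G)} (h : e ≠ f) : ({e, f} : Finset E(G)).erase e = {f} :=
  Finset.erase_insert (by simpa using h)

lemma erase_pair_right {e f : E(G)} (h : e ≠ f) : ({e, f} : Finset E(G)).erase f = {e} := by
  rw [Finset.pair_comm, erase_pair_left h.symm]

lemma edgeSign_pair (R : Type*) [CommRing R] {e f : E(G)} (h : e ≠ f) :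
    edgeSign R {e, f} f = -edgeSign R {e, f} e := by
  have := edgeSign_swap R (t := {e, f}) (e := e) (f := f) (by simp) (by simp) h
  rw [erase_pair_left h, erase_pair_right h, edgeSign_singleton, edgeSign_singleton, mul_one,
    mul_one] at this
  rw [this, neg_neg]

lemma joins_erase {t : Finset E(G)} {e : E(G)} (he : e ∈ t) {u w : V(G)}
    (hl : G.IsLink (e : β) (u : α) (w : α))
    (hne : Component.mk (t.erase e) u ≠ Component.mk (t.erase e) w) :
    Joins (Component.incl (Finset.erase_subset e t)) (Component.mk (t.erase e) u)
      (Component.mk (t.erase e) w) :=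
  Component.joins_incl _ he (fun _ hf hfe => Finset.mem_erase.2 ⟨hfe, hf⟩) hl hne

end Pairs

/-! ### Elements of order two -/

section Witness

variable {α β : Type*} {G : Graph α β} [Finite V(G)] [LinearOrder E(G)]

lemma topCoeff_merge_erase (F : ∀ s : Finset E(G), VertexModule ℤ G s) {t : Finset E(G)} {e : E(G)}
    (he : e ∈ t) {u w : V(G)} (hl : G.IsLink (e : β) (u : α) (w : α))
    (hne : Component.mk (t.erase e) u ≠ Component.mk (t.erase e) w) :
    topCoeff ℤ t (merge ℤ (Finset.erase_subset e t) (F (t.erase e))) =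
      markCoeffAt F (t.erase e) u + markCoeffAt F (t.erase e) w := by
  rw [merge_eq_push, (joins_erase he hl hne).topCoeff_push]
  rfl

lemma topCoeff_totalD_singleton (F : ∀ s : Finset E(G), VertexModule ℤ G s) {e : E(G)}
    {u w : V(G)} (hl : G.IsLink (e : β) (u : α) (w : α)) (hne : u ≠ w) :
    topCoeff ℤ {e} (totalD ℤ F {e}) = markCoeffAt F ∅ u + markCoeffAt F ∅ w := by
  rw [totalD_apply, Finset.sum_singleton, edgeSign_singleton, one_smul,
    topCoeff_merge_erase F (Finset.mem_singleton_self e) hl, Finset.erase_singleton]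
  rw [Finset.erase_singleton]
  exact Component.mk_empty_bijective.injective.ne hne

lemma topCoeff_totalD_pair (F : ∀ s : Finset E(G), VertexModule ℤ G s) {e f : E(G)}
    (hef : e ≠ f) {u w u' w' : V(G)} (hl : G.IsLink (e : β) (u : α) (w : α))
    (hl' : G.IsLink (f : β) (u' : α) (w' : α)) (hne : Component.mk {f} u ≠ Component.mk {f} w)
    (hne' : Component.mk {e} u' ≠ Component.mk {e} w') :
    topCoeff ℤ {e, f} (totalD ℤ F {e, f}) = edgeSign ℤ {e, f} e *
      ((markCoeffAt F {f} u + markCoeffAt F {f} w) -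
        (markCoeffAt F {e} u' + markCoeffAt F {e} w')) := by
  rw [totalD_apply, Finset.sum_pair hef, map_add, map_smul, map_smul,
    topCoeff_merge_erase F (by simp) hl (by rwa [erase_pair_left hef]),
    topCoeff_merge_erase F (by simp) hl' (by rwa [erase_pair_right hef]), erase_pair_left hef,
    erase_pair_right hef, edgeSign_pair ℤ hef, smul_eq_mul, smul_eq_mul]
  ring

variable (G) in
/-- `z` represents an element of order `2` in the cohomology of degree `(i + 1, j)`: it is not a
coboundary, but twice `z` is the coboundary of a homogeneous cochain. -/
structure IsTorsionWitness (i j : ℕ) (φ : Cochain ℤ G i) (z : Cochain ℤ G (i + 1)) : Prop where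
  mem_left : φ ∈ Cochain.homogeneous ℤ G i j
  mem_right : z ∈ Cochain.homogeneous ℤ G (i + 1) j
  two_smul_eq : (2 : ℤ) • z = d ℤ G i φ
  notMem_range : z ∉ LinearMap.range (d ℤ G i)

lemma notMem_range_d {i : ℕ} {φ : Cochain ℤ G i} {z : Cochain ℤ G (i + 1)}
    (hz : (2 : ℤ) • z = d ℤ G i φ) (h : ∀ ψ, d ℤ G i (φ - (2 : ℤ) • ψ) ≠ 0) :
    z ∉ LinearMap.range (d ℤ G i) := by
  rintro ⟨ψ, rfl⟩
  exact h ψ (by rw [map_sub, map_smul, hz, sub_self])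

lemma totalD_extendZero_eq_zero {i : ℕ} {φ : Cochain ℤ G i} (h : d ℤ G i φ = 0) :
    totalD ℤ (extendZero ℤ φ) = 0 := by
  funext t
  by_cases ht : t.card = i + 1
  · rw [← d_eq_totalD ℤ φ ⟨t, ht⟩, h]; rfl
  · exact totalD_extendZero_of_ne ℤ φ ht

/-- The sum of the elements `topElem {e}` over all edges `e` has order `2` if there is an odd cycle:
twice this sum is the coboundary of `sumMark ∅`. -/
lemma isTorsionWitness_of_odd [G.Loopless] {n : ℕ} (hn : Odd n) {v : Fin n → α} {e : Fin n → β}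
    (he : ∀ i, G.IsLink (e i) (v i) (v (finRotate n i))) :
    ∃ φ z, IsTorsionWitness G 0 (Nat.card V(G) - 1) φ z := by
  let φ : Cochain ℤ G 0 := fun s => sumMark ℤ s.1
  let z : Cochain ℤ G (0 + 1) := fun s => topElem ℤ s.1
  have hz : (2 : ℤ) • z = d ℤ G 0 φ := by
    funext ⟨t, ht⟩
    obtain ⟨f, rfl⟩ := Finset.card_eq_one.1 ht
    obtain ⟨x, y, hl⟩ := G.exists_isLink_of_mem_edgeSet f.2
    have hj := joins_erase (Finset.mem_singleton_self f) (u := ⟨x, hl.left_mem⟩)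
      (w := ⟨y, hl.right_mem⟩) hl (by
        rw [Finset.erase_singleton]
        exact Component.mk_empty_bijective.injective.ne fun h => hl.ne (congrArg Subtype.val h))
    rw [d_restrict ℤ 0 (fun s => sumMark ℤ s), totalD_apply, Finset.sum_singleton,
      edgeSign_singleton, one_smul, merge_eq_push, hj.push_sumMark]
    rfl
  refine ⟨φ, z, fun s _ => ?_, fun s _ => ?_, hz, notMem_range_d hz fun ψ hψ => ?_⟩
  · obtain ⟨s, hs⟩ := s
    obtain rfl := Finset.card_eq_zero.1 hs
    rw [← card_component_empty]
    exact sumMark_mem_homogeneous ℤ _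
  · obtain ⟨s, hs⟩ := s
    obtain ⟨f, rfl⟩ := Finset.card_eq_one.1 hs
    rw [← card_component_singleton f]
    exact topElem_mem_homogeneous ℤ _
  · -- The coefficients of a cocycle of degree `0` at the two ends of an edge add up to `0`; along
    -- an odd cycle this makes them `0`, but they are odd.
    have hF := totalD_extendZero_eq_zero hψ
    set F := extendZero ℤ (φ - (2 : ℤ) • ψ) with hFdef
    let V : Fin n → V(G) := fun i => ⟨v i, (he i).left_mem⟩
    have h0 := eq_zero_of_add_finRotate_eq_zero hn (fun i => markCoeffAt F ∅ (V i)) (fun i => by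
      have h1 := topCoeff_totalD_singleton F (e := ⟨e i, (he i).edge_mem⟩) (u := V i)
        (w := V (finRotate n i)) (he i) (fun h => (he i).ne (congrArg Subtype.val h))
      rw [hF, Pi.zero_apply, map_zero] at h1
      exact h1.symm) ⟨0, hn.pos⟩
    have hodd : markCoeffAt F ∅ (V ⟨0, hn.pos⟩) = 1 - 2 *
        markCoeff ℤ ∅ (Component.mk ∅ (V ⟨0, hn.pos⟩)) (ψ ⟨∅, Finset.card_empty⟩) := by
      rw [markCoeffAt, hFdef, extendZero_of_card ℤ _ Finset.card_empty, Pi.sub_apply,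
        Pi.smul_apply, map_sub, map_smul, markCoeff_sumMark, smul_eq_mul]
    omega

/-- Let `e 0` be an edge of an even cycle of length at least `3`. The coboundary of the sum of the
elements `sumMark {f}` over all edges `f` parallel to `e 0` is divisible by `2`, and the quotient by
`2` has order `2`. -/
lemma isTorsionWitness_of_even [G.Loopless] {n : ℕ} (hn : Even n) (hn3 : 3 ≤ n) {v : Fin n → α}
    {e : Fin n → β} (hv : Function.Injective v) (hinj : Function.Injective e)
    (he : ∀ i, G.IsLink (e i) (v i) (v (finRotate n i))) :
    ∃ φ z, IsTorsionWitness G 1 (Nat.card V(G) - 2) φ z := by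
  let o : Fin n := ⟨0, by omega⟩
  let τ : Finset E(G) → ℤ := linkIndicator (v o) (v (finRotate n o))
  let φ' : ∀ s : Finset E(G), VertexModule ℤ G s := fun s => τ s • sumMark ℤ s
  let φ : Cochain ℤ G 1 := fun s => φ' s.1
  have hex : ∀ t : {t : Finset E(G) // t.card = 1 + 1},
      ∃ z ∈ VertexModule.homogeneous ℤ G t.1 (Nat.card V(G) - 2), (2 : ℤ) • z = d ℤ G 1 φ t := by
    rintro ⟨t, ht⟩
    obtain ⟨f, g, hfg, rfl⟩ := Finset.card_eq_two.1 ht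
    obtain ⟨x, y, hl⟩ := G.exists_isLink_of_mem_edgeSet f.2
    obtain ⟨x', y', hl'⟩ := G.exists_isLink_of_mem_edgeSet g.2
    have hd : d ℤ G 1 φ ⟨{f, g}, ht⟩ = edgeSign ℤ {f, g} f •
        (τ {g} • push ℤ (Component.incl (Finset.erase_subset f {f, g})) (sumMark ℤ _) -
          τ {f} • push ℤ (Component.incl (Finset.erase_subset g {f, g})) (sumMark ℤ _)) := by
      rw [d_restrict ℤ 1 φ', totalD_apply, Finset.sum_pair hfg, edgeSign_pair ℤ hfg, smul_sub,
        neg_smul, sub_eq_add_neg]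
      simp only [φ', map_smul, merge_eq_push, erase_pair_left hfg, erase_pair_right hfg]
    by_cases hpar : G.IsLink (f : β) x' y'
    · -- Parallel edges: both per-edge maps are isomorphisms, and the two terms cancel.
      have hτ : τ {g} = τ {f} := linkIndicator_congr hl' hpar
      have h1 := Component.incl_bijective (Finset.erase_subset f {f, g})
        (Finset.mem_insert_self f {g}) (fun _ hf hfe => Finset.mem_erase.2 ⟨hfe, hf⟩)
        (u := ⟨x', hl'.left_mem⟩) (w := ⟨y', hl'.right_mem⟩) hpar (by
          rw [erase_pair_left hfg]
          exact Component.mk_eq (Finset.mem_singleton_self g) hl')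
      have h2 := Component.incl_bijective (Finset.erase_subset g {f, g})
        (by simp) (fun _ hf hfe => Finset.mem_erase.2 ⟨hfe, hf⟩)
        (u := ⟨x', hl'.left_mem⟩) (w := ⟨y', hl'.right_mem⟩) hl' (by
          rw [erase_pair_right hfg]
          exact Component.mk_eq (Finset.mem_singleton_self f) hpar)
      refine ⟨0, Submodule.zero_mem _, ?_⟩
      rw [hd, push_sumMark_of_bijective ℤ h1, push_sumMark_of_bijective ℤ h2, hτ, sub_self,
        smul_zero, smul_zero]
    · have hpar' : ¬ G.IsLink (g : β) x y := fun h => hpar <| by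
        rcases h.eq_and_eq_or_eq_and_eq hl' with ⟨rfl, rfl⟩ | ⟨rfl, rfl⟩
        exacts [hl, hl.symm]
      have h1 := joins_erase (t := {f, g}) (Finset.mem_insert_self f {g})
        (u := ⟨x, hl.left_mem⟩) (w := ⟨y, hl.right_mem⟩) hl (by
          rw [erase_pair_left hfg]
          exact mk_singleton_ne (u := ⟨x, hl.left_mem⟩) (w := ⟨y, hl.right_mem⟩) hl hpar')
      have h2 := joins_erase (t := {f, g}) (e := g) (by simp)
        (u := ⟨x', hl'.left_mem⟩) (w := ⟨y', hl'.right_mem⟩) hl' (by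
          rw [erase_pair_right hfg]
          exact mk_singleton_ne (u := ⟨x', hl'.left_mem⟩) (w := ⟨y', hl'.right_mem⟩) hl' hpar)
      have hcard := h1.card
      rw [erase_pair_left hfg, card_component_singleton g] at hcard
      refine ⟨(edgeSign ℤ {f, g} f * (τ {g} - τ {f})) • topElem ℤ {f, g}, ?_, ?_⟩
      · rw [show Nat.card V(G) - 2 = Fintype.card (Component G {f, g}) by omega]
        exact Submodule.smul_mem _ _ (topElem_mem_homogeneous ℤ _)
      · rw [hd, h1.push_sumMark, h2.push_sumMark]
        module
  choose z hzmem hz using hex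
  have hz : (2 : ℤ) • z = d ℤ G 1 φ := funext hz
  refine ⟨φ, z, fun s _ => ?_, fun s _ => hzmem s, hz, notMem_range_d hz fun ψ hψ => ?_⟩
  · obtain ⟨s, hs⟩ := s
    obtain ⟨f, rfl⟩ := Finset.card_eq_one.1 hs
    have h := sumMark_mem_homogeneous ℤ ({f} : Finset E(G))
    rw [card_component_singleton f, Nat.sub_sub] at h
    exact Submodule.smul_mem _ _ h
  · have hF := totalD_extendZero_eq_zero hψ
    set F := extendZero ℤ (φ - (2 : ℤ) • ψ) with hFdef
    let V : Fin n → V(G) := fun i => ⟨v i, (he i).left_mem⟩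
    let e' : Fin n → E(G) := fun i => ⟨e i, (he i).edge_mem⟩
    have hp : ∀ i k, markCoeffAt F {e' i} (V k) = τ {e' i} + 2 *
        -markCoeff ℤ {e' i} (Component.mk {e' i} (V k)) (ψ ⟨{e' i}, Finset.card_singleton _⟩) := by
      intro i k
      have h1 : φ ⟨{e' i}, Finset.card_singleton _⟩ = τ {e' i} • sumMark ℤ {e' i} := rfl
      rw [markCoeffAt, hFdef, extendZero_of_card ℤ _ (Finset.card_singleton _), Pi.sub_apply,
        Pi.smul_apply, h1, map_sub, map_smul, map_smul, markCoeff_sumMark, smul_eq_mul,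
        smul_eq_mul]
      ring
    -- On the pairs of edges of the cycle, `F` is a cocycle that agrees modulo `2` with `φ`, so the
    -- parity argument applies; but exactly one edge of the cycle is parallel to `e o`.
    have heven := even_sum_of_symmetric hn (fun i k => markCoeffAt F {e' i} (V k))
      (fun i => τ {e' i})
      (fun i => markCoeffAt_congr F
        (Component.mk_eq (Finset.mem_singleton_self _) (he i)).symm)
      (fun i j hij => by
        have h := topCoeff_totalD_pair F (e := e' j) (f := e' i)
          (fun h => hij (hinj (congrArg Subtype.val h)).symm) (u := V j) (w := V (finRotate n j))
          (u' := V i) (w' := V (finRotate n i)) (he j) (he i)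
          (mk_singleton_ne (e := e' j) (he j) (not_isLink_of_ne hn3 hv he hij))
          (mk_singleton_ne (e := e' i) (he i) (not_isLink_of_ne hn3 hv he hij.symm))
        rw [hF, Pi.zero_apply, map_zero] at h
        have h2 := congrArg (edgeSign ℤ {e' j, e' i} (e' j) * ·) h
        simp only [← mul_assoc, edgeSign_mul_self, mul_zero, one_mul] at h2
        linarith)
      (fun i k => ⟨_, hp i k⟩)
    have hsum : ∑ i, τ {e' i} = 1 := by
      rw [Finset.sum_eq_single o]
      · exact if_pos ⟨_, Finset.mem_singleton_self _, he o⟩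
      · intro i _ hio
        refine if_neg ?_
        rintro ⟨f, hf, hl⟩
        rw [Finset.mem_singleton.1 hf] at hl
        exact not_isLink_of_ne hn3 hv he hio hl
      · exact fun h => absurd (Finset.mem_univ o) h
    rw [hsum] at heven
    exact absurd heven (by decide)

end Witness

/-! ### Torsion in the cohomology -/

section Torsion

variable {α β : Type*} {G : Graph α β} [Finite V(G)] [LinearOrder E(G)]

lemma IsTorsionWitness.mem_ker {i j : ℕ} {φ : Cochain ℤ G i} {z : Cochain ℤ G (i + 1)}
    (h : IsTorsionWitness G i j φ z) : d ℤ G (i + 1) z = 0 := by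
  have h2 : (2 : ℤ) • d ℤ G (i + 1) z = 0 := by rw [← map_smul, h.two_smul_eq, d_d]
  exact (smul_eq_zero.1 h2).resolve_left two_ne_zero

lemma IsTorsionWitness.exists_addOrderOf_eq_two {i j : ℕ} {φ : Cochain ℤ G i}
    {z : Cochain ℤ G (i + 1)} (h : IsTorsionWitness G i j φ z) :
    ∃ c : GradedCohomology ℤ G (i + 1) j, addOrderOf c = 2 := by
  let z' : gradedCocycles ℤ G (i + 1) j := ⟨z, h.mem_ker, h.mem_right⟩
  let N := (gradedCoboundaries ℤ G (i + 1) j).submoduleOf (gradedCocycles ℤ G (i + 1) j)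
  have h2 : (2 : ℕ) • N.mkQ z' = 0 := by
    rw [← map_nsmul, Submodule.mkQ_apply, Submodule.Quotient.mk_eq_zero]
    refine ⟨φ, h.mem_left, ?_⟩
    rw [← h.two_smul_eq, two_smul]
    exact (two_nsmul z).symm
  have h0 : N.mkQ z' ≠ 0 := by
    rw [Submodule.mkQ_apply, Ne, Submodule.Quotient.mk_eq_zero]
    rintro ⟨ψ, -, hψ⟩
    exact h.notMem_range ⟨ψ, hψ⟩
  exact ⟨N.mkQ z', addOrderOf_eq_prime h2 h0⟩

lemma IsTorsionWitness.torsion_ne_bot {i j : ℕ} {φ : Cochain ℤ G i}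
    {z : Cochain ℤ G (i + 1)} (h : IsTorsionWitness G i j φ z) :
    AddCommGroup.torsion (TotalCohomology ℤ G) ≠ ⊥ := by
  let z' : LinearMap.ker (d ℤ G (i + 1)) := ⟨z, h.mem_ker⟩
  let N := (coboundaries ℤ G (i + 1)).submoduleOf (LinearMap.ker (d ℤ G (i + 1)))
  have h2 : (2 : ℕ) • N.mkQ z' = 0 := by
    rw [← map_nsmul, Submodule.mkQ_apply, Submodule.Quotient.mk_eq_zero]
    refine ⟨φ, ?_⟩
    rw [← h.two_smul_eq, two_smul]
    exact (two_nsmul z).symm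
  have h0 : N.mkQ z' ≠ 0 := by
    rw [Submodule.mkQ_apply, Ne, Submodule.Quotient.mk_eq_zero]
    exact h.notMem_range
  let c : Cohomology ℤ G (i + 1) := N.mkQ z'
  have hc : DirectSum.of (fun i => Cohomology ℤ G i) (i + 1) c ∈
      AddCommGroup.torsion (TotalCohomology ℤ G) := by
    refine isOfFinAddOrder_iff_nsmul_eq_zero.2 ⟨2, two_pos, ?_⟩
    rw [← map_nsmul]
    exact (congrArg _ h2).trans (map_zero _)
  intro hbot
  rw [hbot, AddSubgroup.mem_bot] at hc
  exact h0 (DirectSum.of_injective (i + 1) (hc.trans (map_zero _).symm))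

/-- If the cohomology vanishes in positive degrees, it is torsion-free: in degree `0` it is a
submodule of a free module. -/
lemma torsion_eq_bot_of_exact
    (h : ∀ ψ : ∀ s : Finset E(G), VertexModule ℤ G s, totalD ℤ ψ = 0 →
      ∃ η : ∀ s : Finset E(G), VertexModule ℤ G s, ∀ t, t.Nonempty → totalD ℤ η t = ψ t) :
    AddCommGroup.torsion (TotalCohomology ℤ G) = ⊥ := by
  rw [eq_bot_iff]
  intro c hc
  obtain ⟨n, hn, hnc⟩ := isOfFinAddOrder_iff_nsmul_eq_zero.1 hc
  rw [AddSubgroup.mem_bot]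
  refine DFinsupp.ext fun i => ?_
  have hi : n • c i = 0 :=
    (map_nsmul (DFinsupp.evalAddMonoidHom i) n c).symm.trans
      ((congrArg _ hnc).trans (map_zero _))
  obtain ⟨ψ, hψ⟩ := Submodule.mkQ_surjective
    ((coboundaries ℤ G i).submoduleOf (LinearMap.ker (d ℤ G i))) (c i)
  rw [DirectSum.zero_apply, ← hψ]
  refine (Submodule.Quotient.mk_eq_zero _).2 ?_
  rcases i with _ | i
  · have h0 : n • Submodule.mkQ
        ((coboundaries ℤ G 0).submoduleOf (LinearMap.ker (d ℤ G 0))) ψ = 0 := by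
      rw [hψ]; exact hi
    rw [← map_nsmul] at h0
    have h1 : n • ψ.1 = 0 := (Submodule.Quotient.mk_eq_zero _).1 h0
    rw [← natCast_zsmul] at h1
    have h2 := (smul_eq_zero.1 h1).resolve_left (by exact_mod_cast hn.ne')
    exact h2
  · exact coboundaries_eq_ker_of_exact ℤ h i ψ.1 ψ.2

end Torsion

end GraphCohomology

end

theorem theorem4 {α β : Type*} (G : Graph α β) [Finite V(G)] [Finite E(G)] [LinearOrder E(G)] :
    (AddCommGroup.torsion (GraphCohomology.TotalCohomology ℤ G) ≠ ⊥ ↔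
      G.Loopless ∧ ∃ n : ℕ, 3 ≤ n ∧ GraphCohomology.HasCycle G n) ∧
    (G.Loopless → ∀ n : ℕ, 3 ≤ n → GraphCohomology.HasCycle G n →
      (Odd n → ∃ z : GraphCohomology.GradedCohomology ℤ G 1 (Nat.card V(G) - 1),
        addOrderOf z = 2) ∧
      (Even n → ∃ z : GraphCohomology.GradedCohomology ℤ G 2 (Nat.card V(G) - 2),
        addOrderOf z = 2)) := by
  refine ⟨⟨fun htor => ?_, ?_⟩, ?_⟩
  · by_contra hG
    refine htor (GraphCohomology.torsion_eq_bot_of_exact fun ψ hψ => ?_)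
    by_cases hloop : G.Loopless
    · have := Fintype.ofFinite E(G)
      obtain ⟨η, hη⟩ := GraphCohomology.exact_pos_of_no_cycle ℤ hloop
        (fun hcyc => hG ⟨hloop, hcyc⟩) Finset.univ ψ fun t _ => congrFun hψ t
      exact ⟨η, fun t ht => hη t (Finset.subset_univ t) ht⟩
    · obtain ⟨η, hη⟩ := GraphCohomology.exact_of_not_loopless ℤ hloop ψ hψ
      exact ⟨η, fun t _ => congrFun hη t⟩
  · rintro ⟨hG, n, hn, -, v, e, hv, hinj, he⟩
    rcases Nat.even_or_odd n with hpar | hpar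
    · obtain ⟨φ, z, h⟩ := GraphCohomology.isTorsionWitness_of_even hpar hn hv hinj he
      exact h.torsion_ne_bot
    · obtain ⟨φ, z, h⟩ := GraphCohomology.isTorsionWitness_of_odd hpar he
      exact h.torsion_ne_bot
  · rintro hG n hn ⟨-, v, e, hv, hinj, he⟩
    refine ⟨fun hpar => ?_, fun hpar => ?_⟩
    · obtain ⟨φ, z, h⟩ := GraphCohomology.isTorsionWitness_of_odd hpar he
      exact h.exists_addOrderOf_eq_two
    · obtain ⟨φ, z, h⟩ := GraphCohomology.isTorsionWitness_of_even hpar hn hv hinj he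
      exact h.exists_addOrderOf_eq_two
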